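/- Let $n\ge 1$ and let $f:[0,\infty)\to[0,\infty)$ be a Bernstein function without linear term and with $f(0)=0$, i.e. $f(t)=\int_{(0,\infty)}(1-e^{-st})\,\mu(ds)$ for a measure $\mu$ on $(0,\infty)$ with $\int_{(0,\infty)}(1\wedge s)\,\mu(ds)<\infty$. Assume that $f$ is unbounded, so that $f$ is a bijection of $[0,\infty)$ with inverse $f^{-1}$, and that $$\nu(dy)=\mathbf 1_{B(0,1)}(y)\,f\!\left(\frac1{|y|^2}\right)\frac{dy}{|y|^n}$$ is a Lévy measure on $\mathbb R^n$, i.e. $\int (1\wedge|y|^2)\,\nu(dy)<\infty$. Let $(X_t)_{t\ge0}$ be a Lévy process in $\mathbb R^n$ with symbol $$\psi_1(\xi)=\int_{B(0,1)}\bigl(1-\cos(\xi\cdot y)\bigr)\,f\!\left(\frac1{|y|^2}\right)\frac{dy}{|y|^n},\qquad\text{that is, } \mathbb E\,e^{i\xi\cdot X_t}=e^{-t\psi_1(\xi)}.$$ Then for every $t>0$ the law of $X_t$ has a continuous density $p_t$ with respect to Lebesgue measure. Moreover, for $t>0$ and $x\in\mathbb R^n$ the function $$\xi\mapsto v_t(\xi,x):=-\xi\cdot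 x-t\int\bigl(1-\cosh(\xi\cdot y)\bigr)\,\nu(dy),\qquad \xi\in\mathbb R^n,$$ attains its minimum; put $D_t^2(x):=-\min_{\xi\in\mathbb R^n}v_t(\xi,x)$. There exist constants $c,\gamma>0$ such that $$p_t(x)\le c\,e^{-D_t^2(x)}\left[f^{-1}\!\left(\frac1{\gamma t}\right)\right]^{n/2}\qquad\text{for all } 0<t\le 1,\ x\in\mathbb R^n.$$ -/

import Mathlib

open MeasureTheory ProbabilityTheory Filter Topology
open scoped NNReal ENNReal RealInnerProductSpace

noncomputable section

/-- `f(t) = a + b t + ∫_{(0,∞)} (1 - e^{-st}) μ(ds)` for `t ≥ 0`, where `a, b ≥ 0` and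
`∫_{(0,∞)} (1 ∧ s) μ(ds) < ∞`. Only the restriction of `μ` to `(0,∞)` and only the values of `f`
on `[0,∞)` matter. -/
structure BernsteinRep (f : ℝ → ℝ) (a b : ℝ) (μ : Measure ℝ) : Prop where
  const_nonneg : 0 ≤ a
  slope_nonneg : 0 ≤ b
  lintegral_lt_top : ∫⁻ s in Set.Ioi (0 : ℝ), ENNReal.ofReal (min 1 s) ∂μ < ∞
  eq : ∀ t : ℝ, 0 ≤ t → f t = a + b * t + ∫ s in Set.Ioi (0 : ℝ), (1 - Real.exp (-(s * t))) ∂μ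

/-- `f` is (on `[0,∞)`) a Bernstein function without linear term. -/
def IsBernsteinNoLinear (f : ℝ → ℝ) : Prop :=
  ∃ (a : ℝ) (μ : Measure ℝ), BernsteinRep f a 0 μ

/-- A Lévy measure on `ℝⁿ`, a measure on `ℝⁿ ∖ {0}` being a measure on `ℝⁿ` that does not
charge `0`. -/
def IsLevyMeasure {n : ℕ} (ν : Measure (EuclideanSpace ℝ (Fin n))) : Prop :=
  ν {0} = 0 ∧ ∫⁻ y, ENNReal.ofReal (min 1 (‖y‖ ^ 2)) ∂ν < ∞

/-- The real-valued symbol without Gaussian part,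
`ψ(ξ) = ∫ (1 - cos (ξ · y)) ν(dy)`. -/
def levySymbol {n : ℕ} (ν : Measure (EuclideanSpace ℝ (Fin n)))
    (ξ : EuclideanSpace ℝ (Fin n)) : ℝ :=
  ∫ y, (1 - Real.cos ⟪ξ, y⟫) ∂ν

/-- The measure `ν(dy) = 1_{B(0,1)}(y) f(|y|⁻²) |y|⁻ⁿ dy`. -/
def truncJumpMeasure (n : ℕ) (f : ℝ → ℝ) : Measure (EuclideanSpace ℝ (Fin n)) :=
  ((volume : Measure (EuclideanSpace ℝ (Fin n))).restrict (Metric.ball 0 1)).withDensity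
    (fun y => ENNReal.ofReal (f (1 / ‖y‖ ^ 2) / ‖y‖ ^ n))

/-- `ψ₁(ξ) = ∫_{B(0,1)} (1 - cos (ξ · y)) f(|y|⁻²) |y|⁻ⁿ dy`. -/
def psiOne (n : ℕ) (f : ℝ → ℝ) : EuclideanSpace ℝ (Fin n) → ℝ :=
  levySymbol (truncJumpMeasure n f)

/-- A Lévy process: starts at `0`, independent and stationary increments, stochastically
continuous. -/
structure IsLevyProcess {n : ℕ} {Ω : Type*} [MeasurableSpace Ω]
    (X : ℝ≥0 → Ω → EuclideanSpace ℝ (Fin n)) (P : Measure Ω) : Prop where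
  measurable : ∀ t, Measurable (X t)
  zero : ∀ᵐ ω ∂P, X 0 ω = 0
  indep : HasIndepIncrements X P
  stationary : ∀ s t : ℝ≥0, IdentDistrib (fun ω => X (s + t) ω - X s ω) (X t) P P
  stoch_cont : ∀ t : ℝ≥0, TendstoInMeasure P X (𝓝 t) (X t)

/-- The process `X` has the (real-valued) symbol `ψ`: `E e^{i ξ · X_t} = e^{-t ψ(ξ)}`. -/
def HasSymbol {n : ℕ} {Ω : Type*} [MeasurableSpace Ω]
    (X : ℝ≥0 → Ω → EuclideanSpace ℝ (Fin n)) (P : Measure Ω)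
    (ψ : EuclideanSpace ℝ (Fin n) → ℝ) : Prop :=
  ∀ (t : ℝ≥0) (ξ : EuclideanSpace ℝ (Fin n)),
    charFun (P.map (X t)) ξ = ((Real.exp (-((t : ℝ) * ψ ξ)) : ℝ) : ℂ)

/-- `p` is the transition density of `X`: for every `t > 0`, `p_t` is the (unique) continuous
density of the law of `X_t` with respect to Lebesgue measure. -/
def IsContTransitionDensity {n : ℕ} {Ω : Type*} [MeasurableSpace Ω]
    (X : ℝ≥0 → Ω → EuclideanSpace ℝ (Fin n)) (P : Measure Ω)
    (p : ℝ≥0 → EuclideanSpace ℝ (Fin n) → ℝ) : Prop :=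
  ∀ t : ℝ≥0, 0 < t → Continuous (p t) ∧ (∀ x, 0 ≤ p t x) ∧
    P.map (X t) = volume.withDensity (fun x => ENNReal.ofReal (p t x))

/-- `w(ξ) = ∫ (1 - cosh (ξ · y)) ν(dy)` for real `ξ`. -/
def levyW {n : ℕ} (ν : Measure (EuclideanSpace ℝ (Fin n)))
    (ξ : EuclideanSpace ℝ (Fin n)) : ℝ :=
  ∫ y, (1 - Real.cosh ⟪ξ, y⟫) ∂ν

/-- `v_t(ξ, x) = - ξ · x - t w(ξ)`. -/
def levyV {n : ℕ} (ν : Measure (EuclideanSpace ℝ (Fin n))) (t : ℝ)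
    (ξ x : EuclideanSpace ℝ (Fin n)) : ℝ :=
  -⟪ξ, x⟫ - t * levyW ν ξ

/-- `D_t²(x) = - min_ξ v_t(ξ, x)`. -/
def levyDsq {n : ℕ} (ν : Measure (EuclideanSpace ℝ (Fin n))) (t : ℝ)
    (x : EuclideanSpace ℝ (Fin n)) : ℝ :=
  -⨅ ξ, levyV ν t ξ x

end

/-! The density is the inversion integral $(2\pi)^{-n}\int e^{-i\xi\cdot x}e^{-t\psi_1(\xi)}\,d\xi$.
The jump measure lives in the unit ball and has a finite second moment, so $\psi_1$ extends
analytically along complex directions and the contour can be moved to $\mathbb R^n+i\eta$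
(`integral_shiftedIntegrand_eq`). Writing $w$ for `levyW`, one has
$\mathrm{Re}\,\psi_1(\xi+i\eta)\ge\psi_1(\xi)+w(\eta)$ (`re_shiftedSymbol_ge`), hence the integral
is at most $e^{\eta\cdot x-tw(\eta)}\int e^{-t\psi_1}$. For $\eta=-\xi_0$ with $\xi_0$ a minimiser
of $v_t(\cdot,x)$, the prefactor is exactly $e^{-D_t^2(x)}$.

It remains to bound $\int e^{-t\psi_1}$. Each dyadic annulus with radii between $1/|\xi|$ and $1/R$
contributes at least a constant times $f(R^2)$ to $\psi_1(\xi)$, so $\psi_1$ grows like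
$f(R^2)\log(|\xi|/R)$ (`exists_pos_mul_le_psiOne`). Thus $e^{-t\psi_1}$ is bounded by a power of
$R/|\xi|$ with exponent proportional to $tf(R^2)$. Taking $R^2=f^{-1}(1/(\gamma t))$ with $\gamma$
small makes the exponent at least $n+1$ and the integral $O(R^n)$. Since $f$ is unbounded, other
choices of $R$ give integrability for every $t>0$. The Bernstein representation enters through
monotonicity and continuity of $f$. -/

/-! ### Fourier inversion for finite measures with integrable characteristic function. -/

section FourierInversion

open FourierTransform SchwartzMap
open scoped ContDiff

variable {E : Type*} [NormedAddCommGroup E] [InnerProductSpace ℝ E] [FiniteDimensional ℝ E]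
  [MeasurableSpace E] [BorelSpace E]

/-- The inverse Fourier transform of the characteristic function of `μ`. -/
noncomputable def charFunInv (μ : Measure E) (x : E) : ℂ :=
  𝓕 (fun ξ : E => charFun μ ((2 * Real.pi) • ξ)) x

theorem integrable_charFun_two_pi_smul {μ : Measure E} (hφ : Integrable (charFun μ)) :
    Integrable (fun ξ : E => charFun μ ((2 * Real.pi) • ξ)) :=
  hφ.comp_smul (by positivity)

theorem continuous_charFunInv {μ : Measure E} (hφ : Integrable (charFun μ)) :
    Continuous (charFunInv μ) :=
  VectorFourier.fourierIntegral_continuous Real.continuous_fourierChar continuous_inner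
    (integrable_charFun_two_pi_smul hφ)

theorem charFunInv_eq (μ : Measure E) (x : E) :
    charFunInv μ x = ((2 * Real.pi) ^ Module.finrank ℝ E)⁻¹ •
      ∫ ξ : E, Complex.exp (-(Complex.I * ⟪ξ, x⟫)) * charFun μ ξ := by
  have h := Measure.integral_comp_smul (volume : Measure E)
    (fun ξ : E => Complex.exp (-(Complex.I * ⟪ξ, x⟫)) * charFun μ ξ) (2 * Real.pi)
  rw [abs_of_pos (by positivity)] at h
  rw [← h, charFunInv, Real.fourier_eq]
  refine integral_congr_ae (Eventually.of_forall fun ξ => ?_)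
  simp only [Circle.smul_def, Real.fourierChar_apply, smul_eq_mul, inner_smul_left]
  congr 2
  push_cast
  simp
  ring

/-- Fubini is used twice: integrating $h=\mathcal F\mathcal F^{-1}h$ against `μ` produces the
characteristic function, and flipping $\mathcal Fh$ against that function returns to Lebesgue
measure. -/
theorem integral_schwartz_eq_integral_mul_charFunInv {μ : Measure E} [IsFiniteMeasure μ]
    (hφ : Integrable (charFun μ)) (h : 𝓢(E, ℂ)) :
    ∫ x, h x ∂μ = ∫ x, h x * charFunInv μ x := by
  have h1 : ∀ x, h x = 𝓕 ((𝓕⁻ h : 𝓢(E, ℂ)) : E → ℂ) x := fun x => by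
    rw [← SchwartzMap.fourier_coe, fourier_fourierInv_eq]
  have h2 : ∫ x, 𝓕 ((𝓕⁻ h : 𝓢(E, ℂ)) : E → ℂ) x • (1 : ℂ) ∂μ =
      ∫ ξ, (𝓕⁻ h : 𝓢(E, ℂ)) ξ • VectorFourier.fourierIntegral Real.fourierChar μ
        (innerₗ E).flip (fun _ => (1 : ℂ)) ξ :=
    VectorFourier.integral_fourierIntegral_smul_eq_flip (L := innerₗ E)
      Real.continuous_fourierChar continuous_inner (SchwartzMap.integrable _)
      (integrable_const 1)
  have h3 : ∀ ξ, VectorFourier.fourierIntegral Real.fourierChar μ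
        (innerₗ E).flip (fun _ => (1 : ℂ)) ξ = charFun μ ((2 * Real.pi) • -ξ) := by
    intro ξ
    rw [charFun_apply]
    refine integral_congr_ae (Eventually.of_forall fun x => ?_)
    simp only [Circle.smul_def, Real.fourierChar_apply, LinearMap.flip_apply, innerₗ_apply_apply,
      smul_eq_mul, mul_one, inner_smul_right, inner_neg_right]
    rw [real_inner_comm]
  have h4 : ∫ ξ, 𝓕 (h : E → ℂ) ξ • charFun μ ((2 * Real.pi) • ξ) =
      ∫ x, h x • charFunInv μ x := by
    simpa [charFunInv] using! VectorFourier.integral_fourierIntegral_smul_eq_flip (L := innerₗ E)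
      Real.continuous_fourierChar continuous_inner h.integrable
      (integrable_charFun_two_pi_smul hφ)
  simp only [smul_eq_mul, mul_one] at h2 h4
  -- The reflection $\xi\mapsto-\xi$ turns $\mathcal F^{-1}h$ into $\mathcal Fh$.
  rw [integral_congr_ae (Eventually.of_forall h1), h2, ← h4,
    ← integral_neg_eq_self (fun ξ => 𝓕 (h : E → ℂ) ξ * charFun μ ((2 * Real.pi) • ξ))]
  refine integral_congr_ae (Eventually.of_forall fun ξ => ?_)
  simp only [h3, SchwartzMap.fourierInv_coe, Real.fourierInv_eq_fourier_neg]

theorem integral_contDiff_eq_integral_mul_re_charFunInv {μ : Measure E} [IsFiniteMeasure μ]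
    (hφ : Integrable (charFun μ)) {g : E → ℝ} (hg : ContDiff ℝ ∞ g) (hg' : HasCompactSupport g) :
    ∫ x, g x ∂μ = ∫ x, g x * (charFunInv μ x).re := by
  have hc : HasCompactSupport (fun x => (g x : ℂ)) :=
    hg'.comp_left (g := fun r : ℝ => (r : ℂ)) (by simp)
  have hd : ContDiff ℝ ∞ (fun x => (g x : ℂ)) := Complex.ofRealCLM.contDiff.comp hg
  have h := integral_schwartz_eq_integral_mul_charFunInv hφ (hc.toSchwartzMap hd)
  have hco : ∀ x, (hc.toSchwartzMap hd) x = (g x : ℂ) := fun x => rfl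
  simp only [hco] at h
  have hi : Integrable (fun x => (g x : ℂ) * charFunInv μ x) :=
    (hd.continuous.mul (continuous_charFunInv hφ)).integrable_of_hasCompactSupport hc.mul_right
  have := congrArg Complex.re h
  rw [integral_complex_ofReal, Complex.ofReal_re] at this
  rw [this, ← RCLike.re_eq_complex_re, ← integral_re hi]
  simp

/-- An open set is exactly the support of some smooth $f\ge0$, and `Real.smoothTransition (k * f x)`
increases to its indicator. Boundedness of the set gives compact support; general open sets are
exhausted by balls, and outer regularity finishes. -/
theorem Measure.eq_of_integral_contDiff_eq {μ ν : Measure E} [IsFiniteMeasure μ]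
    [IsLocallyFiniteMeasure ν]
    (h : ∀ g : E → ℝ, ContDiff ℝ ∞ g → HasCompactSupport g → ∫ x, g x ∂μ = ∫ x, g x ∂ν) :
    μ = ν := by
  have hbdd : ∀ U : Set E, IsOpen U → Bornology.IsBounded U → μ U = ν U := by
    intro U hU hb
    obtain ⟨f, hfs, hfd, hfr⟩ := hU.exists_contDiff_support_eq (n := ⊤)
    have hf0 : ∀ x, 0 ≤ f x := fun x => (hfr ⟨x, rfl⟩).1
    let g : ℕ → E → ℝ := fun k x => Real.smoothTransition (k * f x)
    have hgd : ∀ k, ContDiff ℝ ∞ (g k) := fun k =>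
      Real.smoothTransition.contDiff.comp (contDiff_const.mul hfd)
    have hgc : ∀ k, HasCompactSupport (g k) := by
      intro k
      have hfc : HasCompactSupport f := by
        rw [HasCompactSupport, tsupport, hfs]
        exact hb.isCompact_closure
      exact hfc.comp_left (g := fun r => Real.smoothTransition (k * r)) (by simp)
    have hlim : ∀ (ρ : Measure E), Tendsto (fun k => ∫⁻ x, ENNReal.ofReal (g k x) ∂ρ) atTop
        (𝓝 (ρ U)) := by
      intro ρ
      rw [← lintegral_indicator_one hU.measurableSet]
      refine lintegral_tendsto_of_tendsto_of_monotone
        (fun k => (hgd k).continuous.measurable.ennreal_ofReal.aemeasurable)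
        (Eventually.of_forall fun x => ?_) (Eventually.of_forall fun x => ?_)
      · intro k l hkl
        refine ENNReal.ofReal_le_ofReal (Real.smoothTransition.monotone ?_)
        exact mul_le_mul_of_nonneg_right (by exact_mod_cast hkl) (hf0 x)
      · by_cases hx : x ∈ U
        · have hpos : 0 < f x := (hf0 x).lt_of_ne' (by rw [← hfs] at hx; exact hx)
          rw [Set.indicator_of_mem hx]
          refine tendsto_const_nhds.congr' ?_
          filter_upwards [eventually_ge_atTop ⌈(f x)⁻¹⌉₊] with k hk
          have : 1 ≤ k * f x := by
            have := (Nat.ceil_le.1 hk)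
            calc 1 = (f x)⁻¹ * f x := by field_simp
              _ ≤ _ := mul_le_mul_of_nonneg_right this hpos.le
          simp [g, Real.smoothTransition.one_of_one_le this]
        · have hz : f x = 0 := by
            rw [← hfs] at hx
            simpa using hx
          simp [g, hz, hx]
    have heq : ∀ k, ∫⁻ x, ENNReal.ofReal (g k x) ∂μ = ∫⁻ x, ENNReal.ofReal (g k x) ∂ν := by
      intro k
      rw [← ofReal_integral_eq_lintegral_ofReal
          ((hgd k).continuous.integrable_of_hasCompactSupport (hgc k))
          (Eventually.of_forall fun x => Real.smoothTransition.nonneg _),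
        ← ofReal_integral_eq_lintegral_ofReal
          ((hgd k).continuous.integrable_of_hasCompactSupport (hgc k))
          (Eventually.of_forall fun x => Real.smoothTransition.nonneg _), h _ (hgd k) (hgc k)]
    exact tendsto_nhds_unique (hlim μ) ((hlim ν).congr fun k => (heq k).symm)
  apply Measure.OuterRegular.ext_isOpen
  intro U hU
  have hun : U = ⋃ k : ℕ, U ∩ Metric.ball 0 k := by
    rw [← Set.inter_iUnion, Metric.iUnion_ball_nat, Set.inter_univ]
  have hmono : Monotone fun k : ℕ => U ∩ Metric.ball (0 : E) k := fun k l hkl =>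
    Set.inter_subset_inter_right _ (Metric.ball_subset_ball (by exact_mod_cast hkl))
  rw [hun, hmono.measure_iUnion, hmono.measure_iUnion]
  congr 1
  ext k
  exact hbdd _ (hU.inter Metric.isOpen_ball) (Metric.isBounded_ball.subset Set.inter_subset_right)

/-- A smooth bump supported where the real part is negative would have a negative `μ`-integral. The
intersection with a ball makes its support compact. -/
theorem re_charFunInv_nonneg {μ : Measure E} [IsFiniteMeasure μ] (hφ : Integrable (charFun μ))
    (x : E) : 0 ≤ (charFunInv μ x).re := by
  by_contra! hx
  have hcont : Continuous fun y => (charFunInv μ y).re :=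
    Complex.continuous_re.comp (continuous_charFunInv hφ)
  have hU : IsOpen ({y | (charFunInv μ y).re < 0} ∩ Metric.ball x 1) :=
    (isOpen_lt hcont continuous_const).inter Metric.isOpen_ball
  obtain ⟨f, hfs, hfd, hfr⟩ := hU.exists_contDiff_support_eq (n := ⊤)
  have hf0 : ∀ y, 0 ≤ f y := fun y => (hfr ⟨y, rfl⟩).1
  have hfc : HasCompactSupport f := by
    rw [HasCompactSupport, tsupport, hfs]
    exact (Metric.isBounded_ball.subset Set.inter_subset_right).isCompact_closure
  have hxf : f x ≠ 0 := by
    have : x ∈ Function.support f := by rw [hfs]; exact ⟨hx, Metric.mem_ball_self one_pos⟩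
    exact this
  have hpos : 0 < ∫ y, -(f y * (charFunInv μ y).re) := by
    refine Continuous.integral_pos_of_hasCompactSupport_nonneg_nonzero (x := x)
      (hfd.continuous.mul hcont).neg (hfc.mul_right.comp_left neg_zero) (fun y => ?_) ?_
    · by_cases hy : f y = 0
      · simp [hy]
      · have : y ∈ Function.support f := hy
        rw [hfs] at this
        have := mul_nonpos_of_nonneg_of_nonpos (hf0 y) (le_of_lt this.1)
        simpa using this
    · exact neg_ne_zero.2 (mul_ne_zero hxf hx.ne)
  rw [integral_neg, ← integral_contDiff_eq_integral_mul_re_charFunInv hφ hfd hfc] at hpos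
  have : 0 ≤ ∫ y, f y ∂μ := integral_nonneg hf0
  linarith

/-- A finite measure with integrable characteristic function has a continuous density. -/
theorem eq_withDensity_of_integrable_charFun {μ : Measure E} [IsFiniteMeasure μ]
    (hφ : Integrable (charFun μ)) :
    μ = volume.withDensity fun x => ENNReal.ofReal (charFunInv μ x).re := by
  have hcont : Continuous fun y => (charFunInv μ y).re :=
    Complex.continuous_re.comp (continuous_charFunInv hφ)
  have : IsLocallyFiniteMeasure
      ((volume : Measure E).withDensity fun x => ENNReal.ofReal (charFunInv μ x).re) :=
    IsLocallyFiniteMeasure.withDensity_ofReal hcont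
  refine Measure.eq_of_integral_contDiff_eq fun g hg hg' => ?_
  rw [integral_contDiff_eq_integral_mul_re_charFunInv hφ hg hg',
    integral_withDensity_eq_integral_toReal_smul hcont.measurable.ennreal_ofReal
      (Eventually.of_forall fun _ => ENNReal.ofReal_lt_top)]
  refine integral_congr_ae (Eventually.of_forall fun y => ?_)
  simp only [ENNReal.toReal_ofReal (re_charFunInv_nonneg hφ y), smul_eq_mul]
  ring

end FourierInversion

/-! ### Monotonicity, continuity and inversion of Bernstein functions. -/

section Bernstein

theorem one_sub_exp_neg_mul_nonneg {s t : ℝ} (hs : 0 ≤ s) (ht : 0 ≤ t) :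
    0 ≤ 1 - Real.exp (-(s * t)) := by
  have : Real.exp (-(s * t)) ≤ 1 := Real.exp_le_one_iff.2 (by nlinarith [mul_nonneg hs ht])
  linarith

/-- One multiple of `min 1 s` dominates the integrand for all parameters up to `T`, as dominated
convergence requires. -/
theorem one_sub_exp_neg_mul_le {s t T : ℝ} (hs : 0 ≤ s) (htT : t ≤ T) (hT : 1 ≤ T) :
    1 - Real.exp (-(s * t)) ≤ T * min 1 s := by
  have h1 : 1 - Real.exp (-(s * t)) ≤ s * t := by linarith [Real.add_one_le_exp (-(s * t))]
  have h2 : 1 - Real.exp (-(s * t)) ≤ 1 := by linarith [Real.exp_pos (-(s * t))]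
  rcases le_total 1 s with h | h
  · rw [min_eq_left h]; linarith
  · rw [min_eq_right h]; nlinarith

theorem BernsteinRep.integrable_min {f : ℝ → ℝ} {a b : ℝ} {μ : Measure ℝ}
    (h : BernsteinRep f a b μ) : IntegrableOn (fun s => min 1 s) (Set.Ioi 0) μ := by
  refine ⟨(by fun_prop : Continuous fun s : ℝ => min 1 s).aestronglyMeasurable, ?_⟩
  rw [hasFiniteIntegral_iff_ofReal]
  · exact h.lintegral_lt_top
  · filter_upwards [self_mem_ae_restrict measurableSet_Ioi] with s hs
    exact le_min zero_le_one (le_of_lt hs)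

theorem BernsteinRep.integrable {f : ℝ → ℝ} {a b : ℝ} {μ : Measure ℝ}
    (h : BernsteinRep f a b μ) {t : ℝ} (ht : 0 ≤ t) :
    IntegrableOn (fun s => 1 - Real.exp (-(s * t))) (Set.Ioi 0) μ := by
  refine (h.integrable_min.const_mul (max 1 t)).mono'
    (by fun_prop : Continuous fun s : ℝ => 1 - Real.exp (-(s * t))).aestronglyMeasurable ?_
  filter_upwards [self_mem_ae_restrict measurableSet_Ioi] with s hs
  rw [Real.norm_of_nonneg (one_sub_exp_neg_mul_nonneg (le_of_lt hs) ht)]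
  exact one_sub_exp_neg_mul_le (le_of_lt hs) (le_max_right _ _) (le_max_left _ _)

theorem BernsteinRep.monotoneOn {f : ℝ → ℝ} {a b : ℝ} {μ : Measure ℝ}
    (h : BernsteinRep f a b μ) : MonotoneOn f (Set.Ici 0) := by
  intro t ht u hu htu
  rw [h.eq t ht, h.eq u hu]
  have h1 : ∫ s in Set.Ioi (0 : ℝ), (1 - Real.exp (-(s * t))) ∂μ ≤
      ∫ s in Set.Ioi (0 : ℝ), (1 - Real.exp (-(s * u))) ∂μ := by
    refine setIntegral_mono_on (h.integrable ht) (h.integrable hu) measurableSet_Ioi ?_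
    intro s hs
    have := mul_le_mul_of_nonneg_left htu (le_of_lt hs)
    have := Real.exp_le_exp.2 (neg_le_neg this)
    linarith
  have h2 := mul_le_mul_of_nonneg_left htu h.slope_nonneg
  linarith

theorem BernsteinRep.continuousOn {f : ℝ → ℝ} {a b : ℝ} {μ : Measure ℝ}
    (h : BernsteinRep f a b μ) : ContinuousOn f (Set.Ici 0) := by
  suffices H : ContinuousOn (fun t => ∫ s in Set.Ioi (0 : ℝ), (1 - Real.exp (-(s * t))) ∂μ)
      (Set.Ici 0) from
    ((by fun_prop : ContinuousOn (fun t => a + b * t) (Set.Ici 0)).add H).congr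
      fun t ht => h.eq t ht
  intro t₀ ht₀
  refine continuousWithinAt_of_dominated (bound := fun s => (t₀ + 1) * min 1 s)
    (Eventually.of_forall fun t =>
      (by fun_prop : Continuous fun s : ℝ => 1 - Real.exp (-(s * t))).aestronglyMeasurable)
    ?_ (h.integrable_min.const_mul _) (Eventually.of_forall fun s => by fun_prop)
  have : ∀ᶠ t in 𝓝[Set.Ici 0] t₀, t ≤ t₀ + 1 :=
    nhdsWithin_le_nhds (eventually_le_nhds (by linarith))
  filter_upwards [this, self_mem_nhdsWithin] with t ht ht'
  filter_upwards [self_mem_ae_restrict measurableSet_Ioi] with s hs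
  rw [Real.norm_of_nonneg (one_sub_exp_neg_mul_nonneg (le_of_lt hs) ht')]
  have : (0 : ℝ) ≤ t₀ := ht₀
  exact one_sub_exp_neg_mul_le (le_of_lt hs) ht (by linarith)

/-- The values of the inverse of an unbounded continuous function with `f 0 = 0`. -/
theorem invFunOn_Ici_spec {f : ℝ → ℝ} (hc : ContinuousOn f (Set.Ici 0)) (hf0 : f 0 = 0)
    (hf : Tendsto f atTop atTop) {s : ℝ} (hs : 0 ≤ s) :
    0 ≤ Function.invFunOn f (Set.Ici 0) s ∧ f (Function.invFunOn f (Set.Ici 0) s) = s := by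
  obtain ⟨T, hT, hT0⟩ := ((hf.eventually_ge_atTop s).and (eventually_ge_atTop 0)).exists
  have : s ∈ f '' Set.Icc 0 T :=
    intermediate_value_Icc hT0 (hc.mono Set.Icc_subset_Ici_self) (by rw [hf0]; exact ⟨hs, hT⟩)
  obtain ⟨u, hu, hus⟩ := this
  have hex : ∃ a ∈ Set.Ici (0 : ℝ), f a = s := ⟨u, hu.1, hus⟩
  exact ⟨Function.invFunOn_mem hex, Function.invFunOn_eq hex⟩

end Bernstein

/-! ### Analytic extension of the symbol to complex arguments. -/

section ContourShift

theorem Complex.norm_cos_le_cosh_im (w : ℂ) : ‖Complex.cos w‖ ≤ Real.cosh w.im := by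
  rw [Complex.cos, norm_div, Real.cosh_eq]
  have := norm_add_le (Complex.exp (w * Complex.I)) (Complex.exp (-w * Complex.I))
  simp only [Complex.norm_exp] at this
  simp at this ⊢
  linarith

/-- Mean value inequality on the convex strip $|\mathrm{Im}|\le B$, where the derivative $\cos$ is
bounded by $\cosh B$. -/
theorem Complex.norm_sin_le_cosh_mul {w : ℂ} {B : ℝ} (hw : |w.im| ≤ B) :
    ‖Complex.sin w‖ ≤ Real.cosh B * ‖w‖ := by
  have hconv : Convex ℝ {v : ℂ | |v.im| ≤ B} := by
    have : {v : ℂ | |v.im| ≤ B} = Complex.imLm ⁻¹' Set.Icc (-B) B := by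
      ext v; simp [abs_le]
    rw [this]
    exact (convex_Icc _ _).linear_preimage _
  have h0 : (0 : ℂ) ∈ {v : ℂ | |v.im| ≤ B} := by
    simpa using (abs_nonneg _).trans hw
  have := hconv.norm_image_sub_le_of_norm_hasDerivWithin_le (f := Complex.sin)
    (C := Real.cosh B) (fun v _ => (Complex.hasDerivAt_sin v).hasDerivWithinAt)
    (fun v hv => (Complex.norm_cos_le_cosh_im v).trans
      (Real.cosh_le_cosh.2 (hv.trans (le_abs_self B)))) h0 hw
  simpa using this

theorem Complex.norm_one_sub_cos_le {w : ℂ} {B : ℝ} (hw : |w.im| ≤ B) :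
    ‖1 - Complex.cos w‖ ≤ Real.cosh B ^ 2 * ‖w‖ ^ 2 := by
  have hcos : 1 - Complex.cos w = 2 * Complex.sin (w / 2) ^ 2 := by
    have h1 := Complex.cos_two_mul (w / 2)
    have h2 := Complex.sin_sq_add_cos_sq (w / 2)
    rw [mul_div_cancel₀ w two_ne_zero] at h1
    rw [h1]
    linear_combination (-2 : ℂ) * h2
  have hB : 0 ≤ B := (abs_nonneg _).trans hw
  have h : ‖Complex.sin (w / 2)‖ ≤ Real.cosh B * ‖w / 2‖ := by
    apply Complex.norm_sin_le_cosh_mul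
    have : (w / 2).im = w.im / 2 := by simp
    rw [this, abs_div, abs_two]
    linarith
  rw [hcos, norm_mul, norm_pow]
  have h' := pow_le_pow_left₀ (norm_nonneg _) h 2
  rw [norm_div] at h'
  simp only [Complex.norm_ofNat] at h' ⊢
  nlinarith [sq_nonneg (Real.cosh B * ‖w‖)]

variable {n : ℕ} {ν : Measure (EuclideanSpace ℝ (Fin n))}

theorem integrable_of_norm_le_sq {F : Type*} [NormedAddCommGroup F]
    (hI : Integrable (fun y : EuclideanSpace ℝ (Fin n) => ‖y‖ ^ 2) ν) (hB : ∀ᵐ y ∂ν, ‖y‖ ≤ 1)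
    {k : EuclideanSpace ℝ (Fin n) → F} (hk : Continuous k)
    {C : ℝ} (hC : ∀ y, ‖y‖ ≤ 1 → ‖k y‖ ≤ C * ‖y‖ ^ 2) :
    Integrable k ν :=
  (hI.const_mul C).mono' hk.aestronglyMeasurable (hB.mono hC)

/-- The symbol, its derivative and $w$ all have integrands vanishing quadratically in `y`, locally
uniformly in `ξ`, so the second moment dominates them. -/
theorem continuous_integral_of_norm_le_sq {F : Type*} [NormedAddCommGroup F] [NormedSpace ℝ F]
    (hI : Integrable (fun y : EuclideanSpace ℝ (Fin n) => ‖y‖ ^ 2) ν) (hB : ∀ᵐ y ∂ν, ‖y‖ ≤ 1)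
    {k : EuclideanSpace ℝ (Fin n) → EuclideanSpace ℝ (Fin n) → F}
    (hk : Continuous fun p : EuclideanSpace ℝ (Fin n) × EuclideanSpace ℝ (Fin n) => k p.1 p.2)
    (hC : ∀ R : ℝ, ∃ C, ∀ ξ y, ‖ξ‖ ≤ R → ‖y‖ ≤ 1 → ‖k ξ y‖ ≤ C * ‖y‖ ^ 2) :
    Continuous fun ξ => ∫ y, k ξ y ∂ν := by
  refine continuous_iff_continuousAt.2 fun ξ₀ => ?_
  obtain ⟨C, hC⟩ := hC (‖ξ₀‖ + 1)
  refine continuousAt_of_dominated (bound := fun y => C * ‖y‖ ^ 2)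
    (Eventually.of_forall fun ξ => (hk.comp (Continuous.prodMk_right ξ)).aestronglyMeasurable)
    ?_ (hI.const_mul C)
    (Eventually.of_forall fun y => (hk.comp (Continuous.prodMk_left y)).continuousAt)
  have : ∀ᶠ ξ in 𝓝 ξ₀, ‖ξ‖ ≤ ‖ξ₀‖ + 1 :=
    (continuous_norm.tendsto ξ₀).eventually (eventually_le_nhds (by linarith))
  filter_upwards [this] with ξ hξ
  exact hB.mono fun y hy => hC ξ y hξ hy

/-- The symbol of `ν`, extended to the complex point `ξ + z η`. -/
noncomputable def shiftedSymbol (ν : Measure (EuclideanSpace ℝ (Fin n)))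
    (η ξ : EuclideanSpace ℝ (Fin n)) (z : ℂ) : ℂ :=
  ∫ y, (1 - Complex.cos (⟪ξ, y⟫ + z * ⟪η, y⟫)) ∂ν

/-- The derivative of `shiftedSymbol ν η ξ z` with respect to `z`. -/
noncomputable def shiftedSymbolDeriv (ν : Measure (EuclideanSpace ℝ (Fin n)))
    (η ξ : EuclideanSpace ℝ (Fin n)) (z : ℂ) : ℂ :=
  ∫ y, Complex.sin (⟪ξ, y⟫ + z * ⟪η, y⟫) * ⟪η, y⟫ ∂ν

theorem abs_im_phase_le {η ξ y : EuclideanSpace ℝ (Fin n)} {z : ℂ} (hy : ‖y‖ ≤ 1)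
    {B : ℝ} (hB : ‖z‖ * ‖η‖ ≤ B) :
    |((⟪ξ, y⟫ : ℂ) + z * ⟪η, y⟫).im| ≤ B := by
  have h1 : ((⟪ξ, y⟫ : ℂ) + z * ⟪η, y⟫).im = z.im * ⟪η, y⟫ := by simp
  rw [h1, abs_mul]
  calc |z.im| * |⟪η, y⟫| ≤ ‖z‖ * (‖η‖ * ‖y‖) :=
        mul_le_mul (Complex.abs_im_le_norm z) (abs_real_inner_le_norm _ _) (abs_nonneg _)
          (norm_nonneg _)
    _ ≤ ‖z‖ * (‖η‖ * 1) := by gcongr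
    _ ≤ B := by simpa using hB

theorem norm_phase_le {η ξ y : EuclideanSpace ℝ (Fin n)} {z : ℂ} {B : ℝ} (hB : ‖z‖ * ‖η‖ ≤ B) :
    ‖(⟪ξ, y⟫ : ℂ) + z * ⟪η, y⟫‖ ≤ (‖ξ‖ + B) * ‖y‖ := by
  calc ‖(⟪ξ, y⟫ : ℂ) + z * ⟪η, y⟫‖ ≤ |⟪ξ, y⟫| + ‖z‖ * |⟪η, y⟫| := by
        refine (norm_add_le _ _).trans ?_
        simp
    _ ≤ ‖ξ‖ * ‖y‖ + ‖z‖ * (‖η‖ * ‖y‖) := by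
        gcongr <;> exact abs_real_inner_le_norm _ _
    _ = (‖ξ‖ + ‖z‖ * ‖η‖) * ‖y‖ := by ring
    _ ≤ _ := by gcongr

theorem norm_one_sub_cos_phase_le {η ξ y : EuclideanSpace ℝ (Fin n)} {z : ℂ} (hy : ‖y‖ ≤ 1) {B : ℝ}
    (hB : ‖z‖ * ‖η‖ ≤ B) :
    ‖1 - Complex.cos (⟪ξ, y⟫ + z * ⟪η, y⟫)‖ ≤
      (Real.cosh B ^ 2 * (‖ξ‖ + B) ^ 2) * ‖y‖ ^ 2 := by
  refine (Complex.norm_one_sub_cos_le (abs_im_phase_le hy hB)).trans ?_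
  have := pow_le_pow_left₀ (norm_nonneg _) (norm_phase_le (ξ := ξ) (y := y) hB) 2
  rw [mul_assoc, ← mul_pow (‖ξ‖ + B)]
  gcongr

theorem norm_sin_phase_mul_le {η ξ y : EuclideanSpace ℝ (Fin n)} {z : ℂ} (hy : ‖y‖ ≤ 1) {B : ℝ}
    (hB : ‖z‖ * ‖η‖ ≤ B) :
    ‖Complex.sin (⟪ξ, y⟫ + z * ⟪η, y⟫) * ⟪η, y⟫‖ ≤
      (Real.cosh B * (‖ξ‖ + B) * ‖η‖) * ‖y‖ ^ 2 := by
  rw [norm_mul]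
  have h1 := (Complex.norm_sin_le_cosh_mul (abs_im_phase_le (ξ := ξ) hy hB))
  have h2 := norm_phase_le (ξ := ξ) (y := y) hB
  have h3 : ‖((⟪η, y⟫ : ℝ) : ℂ)‖ ≤ ‖η‖ * ‖y‖ := by
    simpa using abs_real_inner_le_norm η y
  calc _ ≤ (Real.cosh B * ((‖ξ‖ + B) * ‖y‖)) * (‖η‖ * ‖y‖) := by
        refine mul_le_mul (h1.trans ?_) h3 (norm_nonneg _) ((norm_nonneg _).trans (h1.trans ?_)) <;>
        exact mul_le_mul_of_nonneg_left h2 (Real.cosh_pos B).le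
    _ = _ := by ring

theorem integrable_one_sub_cos_phase (hI : Integrable (fun y : EuclideanSpace ℝ (Fin n) => ‖y‖ ^ 2) ν)
    (hB : ∀ᵐ y ∂ν, ‖y‖ ≤ 1) (η ξ : EuclideanSpace ℝ (Fin n)) (z : ℂ) :
    Integrable (fun y : EuclideanSpace ℝ (Fin n) => 1 - Complex.cos (⟪ξ, y⟫ + z * ⟪η, y⟫)) ν :=
  integrable_of_norm_le_sq hI hB (by fun_prop)
    fun _ hy => norm_one_sub_cos_phase_le hy le_rfl

theorem continuous_shiftedSymbol (hI : Integrable (fun y : EuclideanSpace ℝ (Fin n) => ‖y‖ ^ 2) ν)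
    (hB : ∀ᵐ y ∂ν, ‖y‖ ≤ 1) (η : EuclideanSpace ℝ (Fin n)) (z : ℂ) :
    Continuous fun ξ => shiftedSymbol ν η ξ z := by
  refine continuous_integral_of_norm_le_sq hI hB
    (k := fun ξ y => 1 - Complex.cos (⟪ξ, y⟫ + z * ⟪η, y⟫)) (by fun_prop) fun R =>
    ⟨Real.cosh (‖z‖ * ‖η‖) ^ 2 * (R + ‖z‖ * ‖η‖) ^ 2, fun ξ y hξ hy =>
      (norm_one_sub_cos_phase_le hy le_rfl).trans ?_⟩
  gcongr

theorem continuous_shiftedSymbolDeriv (hI : Integrable (fun y : EuclideanSpace ℝ (Fin n) => ‖y‖ ^ 2) ν)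
    (hB : ∀ᵐ y ∂ν, ‖y‖ ≤ 1) (η : EuclideanSpace ℝ (Fin n)) (z : ℂ) :
    Continuous fun ξ => shiftedSymbolDeriv ν η ξ z := by
  refine continuous_integral_of_norm_le_sq hI hB
    (k := fun ξ y => Complex.sin (⟪ξ, y⟫ + z * ⟪η, y⟫) * ⟪η, y⟫) (by fun_prop) fun R =>
    ⟨Real.cosh (‖z‖ * ‖η‖) * (R + ‖z‖ * ‖η‖) * ‖η‖, fun ξ y hξ hy =>
      (norm_sin_phase_mul_le hy le_rfl).trans ?_⟩
  have := Real.cosh_pos (‖z‖ * ‖η‖)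
  gcongr

theorem norm_shiftedSymbolDeriv_le (hI : Integrable (fun y : EuclideanSpace ℝ (Fin n) => ‖y‖ ^ 2) ν)
    (hB : ∀ᵐ y ∂ν, ‖y‖ ≤ 1) {η ξ : EuclideanSpace ℝ (Fin n)} {z : ℂ} {B : ℝ} (hzB : ‖z‖ * ‖η‖ ≤ B) :
    ‖shiftedSymbolDeriv ν η ξ z‖ ≤
      Real.cosh B * (‖ξ‖ + B) * ‖η‖ * ∫ y, ‖y‖ ^ 2 ∂ν := by
  rw [shiftedSymbolDeriv, ← integral_const_mul]
  exact norm_integral_le_of_norm_le (hI.const_mul _)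
    (hB.mono fun y hy => norm_sin_phase_mul_le hy hzB)

theorem hasDerivAt_shiftedSymbol (hI : Integrable (fun y : EuclideanSpace ℝ (Fin n) => ‖y‖ ^ 2) ν)
    (hB : ∀ᵐ y ∂ν, ‖y‖ ≤ 1) (η ξ : EuclideanSpace ℝ (Fin n)) (z : ℂ) :
    HasDerivAt (shiftedSymbol ν η ξ) (shiftedSymbolDeriv ν η ξ z) z := by
  set B : ℝ := (‖z‖ + 1) * ‖η‖
  refine (hasDerivAt_integral_of_dominated_loc_of_deriv_le
    (F := fun (z : ℂ) (y : EuclideanSpace ℝ (Fin n)) => 1 - Complex.cos (⟪ξ, y⟫ + z * ⟪η, y⟫))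
    (F' := fun (z : ℂ) (y : EuclideanSpace ℝ (Fin n)) => Complex.sin (⟪ξ, y⟫ + z * ⟪η, y⟫) * ⟪η, y⟫)
    (bound := fun y => (Real.cosh B * (‖ξ‖ + B) * ‖η‖) * ‖y‖ ^ 2)
    (Metric.ball_mem_nhds z one_pos)
    (Eventually.of_forall fun w =>
      (integrable_one_sub_cos_phase hI hB η ξ w).aestronglyMeasurable)
    (integrable_one_sub_cos_phase hI hB η ξ z)
    (by fun_prop : Continuous fun y : EuclideanSpace ℝ (Fin n) =>
      Complex.sin (⟪ξ, y⟫ + z * ⟪η, y⟫) * ⟪η, y⟫).aestronglyMeasurable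
    (hB.mono fun y hy w hw => norm_sin_phase_mul_le hy ?_) (hI.const_mul _)
    (Eventually.of_forall fun y w _ => ?_)).2
  · have : ‖w‖ ≤ ‖z‖ + 1 := by
      have h1 := norm_add_le (w - z) z
      rw [Metric.mem_ball, dist_eq_norm] at hw
      simp at h1
      linarith
    exact mul_le_mul_of_nonneg_right this (norm_nonneg _)
  · have h1 : HasDerivAt (fun w : ℂ => (⟪ξ, y⟫ : ℂ) + w * ⟪η, y⟫) ⟪η, y⟫ w := by
      simpa using! ((hasDerivAt_id w).mul_const (⟪η, y⟫ : ℂ)).const_add (⟪ξ, y⟫ : ℂ)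
    simpa using! (h1.ccos.const_sub 1)

theorem integrable_one_sub_cos (hI : Integrable (fun y : EuclideanSpace ℝ (Fin n) => ‖y‖ ^ 2) ν)
    (hB : ∀ᵐ y ∂ν, ‖y‖ ≤ 1) (ξ : EuclideanSpace ℝ (Fin n)) :
    Integrable (fun y : EuclideanSpace ℝ (Fin n) => 1 - Real.cos ⟪ξ, y⟫) ν := by
  have := (integrable_one_sub_cos_phase hI hB 0 ξ 0).re
  simpa [← Complex.ofReal_cos, Complex.ofReal_re] using! this

theorem integrable_one_sub_cosh (hI : Integrable (fun y : EuclideanSpace ℝ (Fin n) => ‖y‖ ^ 2) ν)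
    (hB : ∀ᵐ y ∂ν, ‖y‖ ≤ 1) (ξ : EuclideanSpace ℝ (Fin n)) :
    Integrable (fun y : EuclideanSpace ℝ (Fin n) => 1 - Real.cosh ⟪ξ, y⟫) ν := by
  have := (integrable_one_sub_cos_phase hI hB ξ 0 Complex.I).re
  simpa [mul_comm Complex.I, Complex.cos_mul_I, ← Complex.ofReal_cosh] using! this

theorem shiftedSymbol_zero
    (η ξ : EuclideanSpace ℝ (Fin n)) : shiftedSymbol ν η ξ 0 = (levySymbol ν ξ : ℂ) := by
  rw [shiftedSymbol, levySymbol, ← integral_complex_ofReal]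
  simp

theorem continuous_levySymbol (hI : Integrable (fun y : EuclideanSpace ℝ (Fin n) => ‖y‖ ^ 2) ν)
    (hB : ∀ᵐ y ∂ν, ‖y‖ ≤ 1) : Continuous (levySymbol ν) := by
  have := Complex.continuous_re.comp (continuous_shiftedSymbol hI hB 0 0)
  refine this.congr fun ξ => ?_
  simp [shiftedSymbol_zero]

theorem levySymbol_nonneg (ξ : EuclideanSpace ℝ (Fin n)) : 0 ≤ levySymbol ν ξ :=
  integral_nonneg fun y => by simpa using Real.cos_le_one ⟪ξ, y⟫

/-- With $c=\cos(\xi\cdot y)$ and $h=\cosh(s\,\eta\cdot y)$ the real part of the integrand is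
$1-ch=(1-c)+(1-h)+(1-c)(h-1)$, whose last term is nonnegative. Replacing `s` by `S` in $w$ makes the
bound uniform over $|s|\le S$, for use under the integral sign. -/
theorem re_shiftedSymbol_ge (hI : Integrable (fun y : EuclideanSpace ℝ (Fin n) => ‖y‖ ^ 2) ν)
    (hB : ∀ᵐ y ∂ν, ‖y‖ ≤ 1) (η ξ : EuclideanSpace ℝ (Fin n)) {s S : ℝ} (hs : |s| ≤ S) :
    levyW ν (S • η) + levySymbol ν ξ ≤ (shiftedSymbol ν η ξ (s * Complex.I)).re := by
  have hre : (shiftedSymbol ν η ξ (s * Complex.I)).re =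
      ∫ y, (1 - Complex.cos (⟪ξ, y⟫ + s * Complex.I * ⟪η, y⟫)).re ∂ν :=
    (integral_re (integrable_one_sub_cos_phase hI hB η ξ (s * Complex.I))).symm
  rw [hre, levyW, levySymbol, ← integral_add (integrable_one_sub_cosh hI hB _)
    (integrable_one_sub_cos hI hB _)]
  refine integral_mono ((integrable_one_sub_cosh hI hB _).add (integrable_one_sub_cos hI hB _))
    (integrable_one_sub_cos_phase hI hB η ξ (s * Complex.I)).re fun y => ?_
  have h1 : (Complex.cos (⟪ξ, y⟫ + s * Complex.I * ⟪η, y⟫)).re =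
      Real.cos ⟪ξ, y⟫ * Real.cosh (s * ⟪η, y⟫) := by
    have : (s : ℂ) * Complex.I * ⟪η, y⟫ = ((s * ⟪η, y⟫ : ℝ) : ℂ) * Complex.I := by
      push_cast; ring
    rw [this, Complex.cos_add_mul_I]
    simp [← Complex.ofReal_cos, ← Complex.ofReal_cosh, ← Complex.ofReal_sin,
      ← Complex.ofReal_sinh, -Complex.ofReal_mul]
  have h2 : Real.cosh (s * ⟪η, y⟫) ≤ Real.cosh ⟪S • η, y⟫ := by
    rw [inner_smul_left, Real.cosh_le_cosh, abs_mul, abs_mul]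
    simp only [conj_trivial]
    exact mul_le_mul_of_nonneg_right (hs.trans (le_abs_self S)) (abs_nonneg _)
  simp only [Complex.sub_re, Complex.one_re, h1]
  nlinarith [Real.cos_le_one ⟪ξ, y⟫, Real.one_le_cosh (s * ⟪η, y⟫)]

end ContourShift

/-! ### Moving the contour of the inversion integral. -/

section ContourIntegral

variable {n : ℕ} {ν : Measure (EuclideanSpace ℝ (Fin n))}

/-- The integrand of the Fourier inversion formula of `exp (-t ψ)` at the complex point
`ξ + z η`. -/
noncomputable def shiftedIntegrand (ν : Measure (EuclideanSpace ℝ (Fin n))) (t : ℝ)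
    (x η ξ : EuclideanSpace ℝ (Fin n)) (z : ℂ) : ℂ :=
  Complex.exp (-(Complex.I * (⟪ξ, x⟫ + z * ⟪η, x⟫)) - t * shiftedSymbol ν η ξ z)

/-- The logarithmic derivative of `shiftedIntegrand ν t x η ξ z` with respect to `z`. -/
noncomputable def shiftedIntegrandLogDeriv (ν : Measure (EuclideanSpace ℝ (Fin n))) (t : ℝ)
    (x η ξ : EuclideanSpace ℝ (Fin n)) (z : ℂ) : ℂ :=
  -(Complex.I * ⟪η, x⟫) - t * shiftedSymbolDeriv ν η ξ z

/-- Translating `ξ` by a real multiple of `η` is a real increment of `z`, so the complex derivative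
in `z` is also the derivative in `ξ` along `η`. -/
theorem shiftedSymbol_add_smul (η ξ : EuclideanSpace ℝ (Fin n)) (a : ℝ) (z : ℂ) :
    shiftedSymbol ν η (ξ + a • η) z = shiftedSymbol ν η ξ (z + a) := by
  simp only [shiftedSymbol, inner_add_left, inner_smul_left]
  congr with y
  push_cast
  simp
  ring_nf

theorem shiftedIntegrand_add_smul (t : ℝ) (x η ξ : EuclideanSpace ℝ (Fin n)) (a : ℝ) (z : ℂ) :
    shiftedIntegrand ν t x η (ξ + a • η) z = shiftedIntegrand ν t x η ξ (z + a) := by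
  simp only [shiftedIntegrand, shiftedSymbol_add_smul, inner_add_left, inner_smul_left]
  congr 3
  push_cast
  simp
  ring_nf

theorem hasDerivAt_shiftedIntegrand (hI : Integrable (fun y : EuclideanSpace ℝ (Fin n) => ‖y‖ ^ 2) ν)
    (hB : ∀ᵐ y ∂ν, ‖y‖ ≤ 1) (t : ℝ) (x η ξ : EuclideanSpace ℝ (Fin n)) (z : ℂ) :
    HasDerivAt (shiftedIntegrand ν t x η ξ)
      (shiftedIntegrand ν t x η ξ z * shiftedIntegrandLogDeriv ν t x η ξ z) z := by
  have h1 : HasDerivAt (fun w : ℂ => -(Complex.I * ((⟪ξ, x⟫ : ℂ) + w * ⟪η, x⟫)))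
      (-(Complex.I * ⟪η, x⟫)) z := by
    simpa using!
      ((((hasDerivAt_id z).mul_const (⟪η, x⟫ : ℂ)).const_add (⟪ξ, x⟫ : ℂ)).const_mul Complex.I).neg
  exact (h1.sub ((hasDerivAt_shiftedSymbol hI hB η ξ z).const_mul (t : ℂ))).cexp

theorem hasLineDerivAt_shiftedIntegrand
    (hI : Integrable (fun y : EuclideanSpace ℝ (Fin n) => ‖y‖ ^ 2) ν)
    (hB : ∀ᵐ y ∂ν, ‖y‖ ≤ 1) (t : ℝ) (x η ξ : EuclideanSpace ℝ (Fin n)) (z : ℂ) :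
    HasLineDerivAt ℝ (fun ξ => shiftedIntegrand ν t x η ξ z)
      (shiftedIntegrand ν t x η ξ z * shiftedIntegrandLogDeriv ν t x η ξ z) ξ η := by
  rw [HasLineDerivAt]
  simp only [shiftedIntegrand_add_smul]
  have h1 : HasDerivAt (fun a : ℝ => z + (a : ℂ)) 1 0 := by
    simpa using! ((hasDerivAt_id (0 : ℝ)).ofReal_comp.const_add z)
  have h2 := hasDerivAt_shiftedIntegrand hI hB t x η ξ (z + ((0 : ℝ) : ℂ))
  simpa using! h2.comp (0 : ℝ) h1

theorem continuous_shiftedIntegrand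
    (hI : Integrable (fun y : EuclideanSpace ℝ (Fin n) => ‖y‖ ^ 2) ν)
    (hB : ∀ᵐ y ∂ν, ‖y‖ ≤ 1) (t : ℝ) (x η : EuclideanSpace ℝ (Fin n)) (z : ℂ) :
    Continuous fun ξ => shiftedIntegrand ν t x η ξ z := by
  have := continuous_shiftedSymbol hI hB η z
  unfold shiftedIntegrand
  fun_prop

theorem continuous_shiftedIntegrandLogDeriv
    (hI : Integrable (fun y : EuclideanSpace ℝ (Fin n) => ‖y‖ ^ 2) ν)
    (hB : ∀ᵐ y ∂ν, ‖y‖ ≤ 1) (t : ℝ) (x η : EuclideanSpace ℝ (Fin n)) (z : ℂ) :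
    Continuous fun ξ => shiftedIntegrandLogDeriv ν t x η ξ z := by
  have := continuous_shiftedSymbolDeriv hI hB η z
  unfold shiftedIntegrandLogDeriv
  fun_prop

theorem norm_shiftedIntegrand_le
    (hI : Integrable (fun y : EuclideanSpace ℝ (Fin n) => ‖y‖ ^ 2) ν)
    (hB : ∀ᵐ y ∂ν, ‖y‖ ≤ 1) {t : ℝ} (ht : 0 ≤ t) (x η ξ : EuclideanSpace ℝ (Fin n)) {s S : ℝ}
    (hs : |s| ≤ S) :
    ‖shiftedIntegrand ν t x η ξ (s * Complex.I)‖ ≤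
      Real.exp (s * ⟪η, x⟫ - t * levyW ν (S • η)) * Real.exp (-(t * levySymbol ν ξ)) := by
  rw [shiftedIntegrand, Complex.norm_exp, ← Real.exp_add, Real.exp_le_exp]
  have h1 := mul_le_mul_of_nonneg_left (re_shiftedSymbol_ge hI hB η ξ hs) ht
  simp
  linarith

/-- The linear growth comes from bounding the sine by its argument; it is the reason for the weight
$1+\|\xi\|$ in the integrability assumptions. -/
theorem norm_shiftedIntegrandLogDeriv_le
    (hI : Integrable (fun y : EuclideanSpace ℝ (Fin n) => ‖y‖ ^ 2) ν)
    (hB : ∀ᵐ y ∂ν, ‖y‖ ≤ 1) (t : ℝ) (x η : EuclideanSpace ℝ (Fin n)) (S : ℝ) :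
    ∃ C, 0 ≤ C ∧ ∀ ξ, ∀ z : ℂ, ‖z‖ ≤ S →
      ‖shiftedIntegrandLogDeriv ν t x η ξ z‖ ≤ C * (1 + ‖ξ‖) := by
  by_cases hS : 0 ≤ S
  swap
  · exact ⟨0, le_rfl, fun ξ z hz => absurd ((norm_nonneg z).trans hz) hS⟩
  set B := S * ‖η‖
  have hB0 : 0 ≤ B := by positivity
  set K := Real.cosh B * ‖η‖ * ∫ y, ‖y‖ ^ 2 ∂ν
  have hK : 0 ≤ K := mul_nonneg (mul_nonneg (Real.cosh_pos B).le (norm_nonneg _))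
    (integral_nonneg fun y => by positivity)
  refine ⟨|⟪η, x⟫| + |t| * K * (1 + B), by positivity, fun ξ z hz => ?_⟩
  have h1 := norm_shiftedSymbolDeriv_le hI hB (ξ := ξ)
    (show ‖z‖ * ‖η‖ ≤ B from mul_le_mul_of_nonneg_right hz (norm_nonneg _))
  have h2 : ‖shiftedSymbolDeriv ν η ξ z‖ ≤ K * ((1 + B) * (1 + ‖ξ‖)) := by
    refine h1.trans ?_
    calc _ = K * (‖ξ‖ + B) := by ring
      _ ≤ _ := by
        gcongr
        nlinarith [norm_nonneg ξ, mul_nonneg hB0 (norm_nonneg ξ)]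
  calc ‖shiftedIntegrandLogDeriv ν t x η ξ z‖ ≤
      |⟪η, x⟫| + |t| * ‖shiftedSymbolDeriv ν η ξ z‖ := by
        refine (norm_sub_le _ _).trans ?_
        simp
    _ ≤ |⟪η, x⟫| * (1 + ‖ξ‖) + |t| * (K * ((1 + B) * (1 + ‖ξ‖))) := by
        gcongr
        nlinarith [norm_nonneg ξ, abs_nonneg ⟪η, x⟫, mul_nonneg (abs_nonneg ⟪η, x⟫) (norm_nonneg ξ)]
    _ = _ := by ring

theorem norm_shiftedIntegrand_mul_logDeriv_le
    (hI : Integrable (fun y : EuclideanSpace ℝ (Fin n) => ‖y‖ ^ 2) ν)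
    (hB : ∀ᵐ y ∂ν, ‖y‖ ≤ 1) {t : ℝ} (ht : 0 ≤ t) (x η : EuclideanSpace ℝ (Fin n)) (S : ℝ) :
    ∃ C, ∀ ξ, ∀ s : ℝ, |s| ≤ S →
      ‖shiftedIntegrand ν t x η ξ (s * Complex.I) *
        shiftedIntegrandLogDeriv ν t x η ξ (s * Complex.I)‖ ≤
      C * ((1 + ‖ξ‖) * Real.exp (-(t * levySymbol ν ξ))) := by
  obtain ⟨C, hC0, hC⟩ := norm_shiftedIntegrandLogDeriv_le hI hB t x η S
  refine ⟨Real.exp (S * |⟪η, x⟫| - t * levyW ν (S • η)) * C, fun ξ s hs => ?_⟩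
  rw [norm_mul]
  have h1 := norm_shiftedIntegrand_le hI hB ht x η ξ hs
  have h2 := hC ξ (s * Complex.I) (by simpa using hs)
  have h3 : s * ⟪η, x⟫ ≤ S * |⟪η, x⟫| := by
    refine (le_abs_self _).trans ?_
    rw [abs_mul]
    exact mul_le_mul_of_nonneg_right hs (abs_nonneg _)
  calc _ ≤ (Real.exp (S * |⟪η, x⟫| - t * levyW ν (S • η)) *
        Real.exp (-(t * levySymbol ν ξ))) * (C * (1 + ‖ξ‖)) := by
        refine mul_le_mul (h1.trans ?_) h2 (norm_nonneg _) (by positivity)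
        gcongr
    _ = _ := by ring

/-- Moving the contour of the Fourier inversion formula by `i s η` does not change the integral. -/
theorem integral_shiftedIntegrand_eq
    (hI : Integrable (fun y : EuclideanSpace ℝ (Fin n) => ‖y‖ ^ 2) ν)
    (hB : ∀ᵐ y ∂ν, ‖y‖ ≤ 1) {t : ℝ} (ht : 0 ≤ t)
    (hint : Integrable fun ξ : EuclideanSpace ℝ (Fin n) => Real.exp (-(t * levySymbol ν ξ)))
    (hint' : Integrable fun ξ : EuclideanSpace ℝ (Fin n) =>
      (1 + ‖ξ‖) * Real.exp (-(t * levySymbol ν ξ))) (x η : EuclideanSpace ℝ (Fin n)) (s : ℝ) :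
    ∫ ξ, shiftedIntegrand ν t x η ξ (s * Complex.I) = ∫ ξ, shiftedIntegrand ν t x η ξ 0 := by
  have hFint : ∀ s : ℝ, Integrable fun ξ => shiftedIntegrand ν t x η ξ (s * Complex.I) := by
    intro s
    exact (hint.const_mul _).mono' (continuous_shiftedIntegrand hI hB t x η _).aestronglyMeasurable
      (Eventually.of_forall fun ξ => norm_shiftedIntegrand_le hI hB ht x η ξ le_rfl)
  have hcont : ∀ s : ℝ, Continuous fun ξ => shiftedIntegrand ν t x η ξ (s * Complex.I) *
      shiftedIntegrandLogDeriv ν t x η ξ (s * Complex.I) := fun s =>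
    (continuous_shiftedIntegrand hI hB t x η _).mul
      (continuous_shiftedIntegrandLogDeriv hI hB t x η _)
  -- The integrand is the derivative along `η` of an integrable function; integrating by parts
  -- against the constant 1 gives zero.
  have hzero : ∀ s : ℝ, ∫ ξ, shiftedIntegrand ν t x η ξ (s * Complex.I) *
      shiftedIntegrandLogDeriv ν t x η ξ (s * Complex.I) = 0 := by
    intro s
    obtain ⟨C, hC⟩ := norm_shiftedIntegrand_mul_logDeriv_le hI hB ht x η |s|
    have hi : Integrable fun ξ => shiftedIntegrand ν t x η ξ (s * Complex.I) *
        shiftedIntegrandLogDeriv ν t x η ξ (s * Complex.I) :=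
      (hint'.const_mul C).mono' (hcont s).aestronglyMeasurable
        (Eventually.of_forall fun ξ => hC ξ s le_rfl)
    have := integral_bilinear_hasLineDerivAt_right_eq_neg_left_of_integrable
      (μ := (volume : Measure (EuclideanSpace ℝ (Fin n))))
      (B := ContinuousLinearMap.mul ℝ ℂ) (f := fun _ => (1 : ℂ)) (f' := fun _ => 0)
      (g := fun ξ => shiftedIntegrand ν t x η ξ (s * Complex.I)) (v := η)
      (g' := fun ξ => shiftedIntegrand ν t x η ξ (s * Complex.I) *
        shiftedIntegrandLogDeriv ν t x η ξ (s * Complex.I))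
      (by simp) (by simpa using hi) (by simpa using hFint s)
      (fun ξ _ => by simpa using! hasDerivAt_const (0 : ℝ) (1 : ℂ))
      (fun ξ _ => hasLineDerivAt_shiftedIntegrand hI hB t x η ξ _)
    simpa using this
  -- The derivative in `s` is $i$ times the integral in `hzero`.
  have hderiv : ∀ s : ℝ, HasDerivAt
      (fun s : ℝ => ∫ ξ, shiftedIntegrand ν t x η ξ (s * Complex.I)) 0 s := by
    intro s
    obtain ⟨C, hC⟩ := norm_shiftedIntegrand_mul_logDeriv_le hI hB ht x η (|s| + 1)
    have h := (hasDerivAt_integral_of_dominated_loc_of_deriv_le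
      (μ := (volume : Measure (EuclideanSpace ℝ (Fin n))))
      (F := fun (s : ℝ) ξ => shiftedIntegrand ν t x η ξ (s * Complex.I))
      (F' := fun (s : ℝ) ξ => (shiftedIntegrand ν t x η ξ (s * Complex.I) *
        shiftedIntegrandLogDeriv ν t x η ξ (s * Complex.I)) * Complex.I)
      (bound := fun ξ => C * ((1 + ‖ξ‖) * Real.exp (-(t * levySymbol ν ξ))))
      (Metric.ball_mem_nhds s one_pos)
      (Eventually.of_forall fun s => (hFint s).aestronglyMeasurable) (hFint s)
      ((hcont s).mul continuous_const).aestronglyMeasurable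
      (Eventually.of_forall fun ξ r hr => ?_) (hint'.const_mul C)
      (Eventually.of_forall fun ξ r _ => ?_)).2
    · rwa [integral_mul_const, hzero, zero_mul] at h
    · rw [norm_mul, Complex.norm_I, mul_one]
      refine hC ξ r ?_
      have h1 := abs_add_le (r - s) s
      rw [Metric.mem_ball, Real.dist_eq] at hr
      simp only [sub_add_cancel] at h1
      linarith
    · have h1 : HasDerivAt (fun r : ℝ => (r : ℂ) * Complex.I) Complex.I r := by
        simpa using! (hasDerivAt_id r).ofReal_comp.mul_const Complex.I
      exact HasDerivAt.comp (h₂ := shiftedIntegrand ν t x η ξ) r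
        (hasDerivAt_shiftedIntegrand hI hB t x η ξ (r * Complex.I)) h1
  have := is_const_of_deriv_eq_zero (fun s => (hderiv s).differentiableAt)
    (fun s => (hderiv s).deriv) s 0
  simpa using this

/-- The Fourier inversion integral of `exp (-t ψ)` after a shift of the contour by `i η`. -/
theorem norm_integral_exp_mul_exp_levySymbol_le
    (hI : Integrable (fun y : EuclideanSpace ℝ (Fin n) => ‖y‖ ^ 2) ν)
    (hB : ∀ᵐ y ∂ν, ‖y‖ ≤ 1) {t : ℝ} (ht : 0 ≤ t)
    (hint : Integrable fun ξ : EuclideanSpace ℝ (Fin n) => Real.exp (-(t * levySymbol ν ξ)))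
    (hint' : Integrable fun ξ : EuclideanSpace ℝ (Fin n) =>
      (1 + ‖ξ‖) * Real.exp (-(t * levySymbol ν ξ))) (x η : EuclideanSpace ℝ (Fin n)) :
    ‖∫ ξ : EuclideanSpace ℝ (Fin n), Complex.exp (-(Complex.I * ⟪ξ, x⟫)) *
        ((Real.exp (-(t * levySymbol ν ξ)) : ℝ) : ℂ)‖ ≤
      Real.exp (⟪η, x⟫ - t * levyW ν η) *
        ∫ ξ : EuclideanSpace ℝ (Fin n), Real.exp (-(t * levySymbol ν ξ)) := by
  have h0 : ∀ ξ : EuclideanSpace ℝ (Fin n), Complex.exp (-(Complex.I * ⟪ξ, x⟫)) *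
      ((Real.exp (-(t * levySymbol ν ξ)) : ℝ) : ℂ) = shiftedIntegrand ν t x η ξ 0 := by
    intro ξ
    rw [shiftedIntegrand, shiftedSymbol_zero, Complex.ofReal_exp, ← Complex.exp_add]
    congr 1
    push_cast
    ring
  simp only [h0]
  rw [← integral_shiftedIntegrand_eq hI hB ht hint hint' x η 1, ← integral_const_mul]
  refine norm_integral_le_of_norm_le (hint.const_mul _) (Eventually.of_forall fun ξ => ?_)
  simpa using norm_shiftedIntegrand_le hI hB ht x η ξ (s := 1) (S := 1) (by simp)

end ContourIntegral

/-! ### Logarithmic lower bound for the symbol by dyadic annuli. -/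

section SymbolLowerBound

variable {n : ℕ}

/-- The annulus `r < |y| < 2 r`. -/
def dyadicAnnulus (n : ℕ) (r : ℝ) : Set (EuclideanSpace ℝ (Fin n)) :=
  {y | r < ‖y‖ ∧ ‖y‖ < 2 * r}

theorem isOpen_dyadicAnnulus (r : ℝ) : IsOpen (dyadicAnnulus n r) :=
  (isOpen_lt continuous_const continuous_norm).inter (isOpen_lt continuous_norm continuous_const)

theorem dyadicAnnulus_subset_ball (r : ℝ) : dyadicAnnulus n r ⊆ Metric.ball 0 (2 * r) :=
  fun y hy => by simpa using hy.2

theorem volume_dyadicAnnulus_lt_top (r : ℝ) :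
    volume (dyadicAnnulus n r) < ∞ :=
  (measure_mono (dyadicAnnulus_subset_ball r)).trans_lt measure_ball_lt_top

theorem integrableOn_dyadicAnnulus {F : Type*} [NormedAddCommGroup F]
    {g : EuclideanSpace ℝ (Fin n) → F} (hg : Continuous g) (r : ℝ) :
    IntegrableOn g (dyadicAnnulus n r) :=
  (hg.continuousOn.integrableOn_compact (isCompact_closedBall 0 (2 * r))).mono_set
    ((dyadicAnnulus_subset_ball r).trans Metric.ball_subset_closedBall)

theorem smul_dyadicAnnulus_one {r : ℝ} (hr : 0 < r) :
    (fun y => r • y) '' dyadicAnnulus n 1 = dyadicAnnulus n r := by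
  ext y
  constructor
  · rintro ⟨z, ⟨h1, h2⟩, rfl⟩
    simp only [dyadicAnnulus, Set.mem_ofPred_eq, norm_smul, Real.norm_of_nonneg hr.le]
    constructor <;> nlinarith
  · rintro ⟨h1, h2⟩
    refine ⟨r⁻¹ • y, ?_, by simp [smul_smul, hr.ne']⟩
    simp only [dyadicAnnulus, Set.mem_ofPred_eq, norm_smul, norm_inv, Real.norm_of_nonneg hr.le]
    constructor
    · rw [inv_mul_eq_div, lt_div_iff₀ hr]; linarith
    · rw [inv_mul_eq_div, div_lt_iff₀ hr]; linarith

/-- The symbol of Lebesgue measure on the annulus `1 < |y| < 2`. -/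
noncomputable def annulusSymbol (n : ℕ) (ζ : EuclideanSpace ℝ (Fin n)) : ℝ :=
  ∫ y in dyadicAnnulus n 1, (1 - Real.cos ⟪ζ, y⟫)

theorem setIntegral_dyadicAnnulus {r : ℝ} (hr : 0 < r) (ξ : EuclideanSpace ℝ (Fin n)) :
    ∫ y in dyadicAnnulus n r, (1 - Real.cos ⟪ξ, y⟫) = r ^ n * annulusSymbol n (r • ξ) := by
  have h := Measure.setIntegral_comp_smul_of_pos (volume : Measure (EuclideanSpace ℝ (Fin n)))
    (fun y => 1 - Real.cos ⟪ξ, y⟫) (dyadicAnnulus n 1) hr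
  rw [← Set.image_smul, smul_dyadicAnnulus_one hr, finrank_euclideanSpace_fin] at h
  have h' : annulusSymbol n (r • ξ) =
      ∫ y in dyadicAnnulus n 1, (1 - Real.cos ⟪ξ, r • y⟫) := by
    simp only [annulusSymbol, inner_smul_left, inner_smul_right, conj_trivial]
  rw [h', h, smul_eq_mul, ← mul_assoc, mul_inv_cancel₀ (pow_pos hr n).ne', one_mul]

theorem continuous_annulusSymbol : Continuous (annulusSymbol n) := by
  have : IsFiniteMeasure (volume.restrict (dyadicAnnulus n 1)) :=
    ⟨by simpa using volume_dyadicAnnulus_lt_top 1⟩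
  refine continuous_of_dominated (bound := fun _ => 2)
    (fun ζ => (by fun_prop : Continuous fun y : EuclideanSpace ℝ (Fin n) =>
      1 - Real.cos ⟪ζ, y⟫).aestronglyMeasurable)
    (fun ζ => Eventually.of_forall fun y => ?_) (integrable_const _)
    (Eventually.of_forall fun y => by fun_prop)
  rw [Real.norm_eq_abs, abs_le]
  constructor <;> linarith [Real.cos_le_one ⟪ζ, y⟫, Real.neg_one_le_cos ⟪ζ, y⟫]

theorem exists_mem_dyadicAnnulus_cos_ne_one {ζ : EuclideanSpace ℝ (Fin n)} (hζ : ζ ≠ 0) :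
    ∃ y ∈ dyadicAnnulus n 1, Real.cos ⟪ζ, y⟫ ≠ 1 := by
  have hpos : 0 < ‖ζ‖ := norm_pos_iff.2 hζ
  have hmem : ∀ s : ℝ, 1 < s → s < 2 → (s / ‖ζ‖) • ζ ∈ dyadicAnnulus n 1 := by
    intro s h1 h2
    have : ‖(s / ‖ζ‖) • ζ‖ = s := by
      rw [norm_smul, Real.norm_of_nonneg (by positivity)]
      field_simp
    simp only [dyadicAnnulus, Set.mem_ofPred_eq, this]
    constructor <;> linarith
  have hinner : ∀ s : ℝ, ⟪ζ, (s / ‖ζ‖) • ζ⟫ = s * ‖ζ‖ := by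
    intro s
    rw [inner_smul_right, real_inner_self_eq_norm_sq]
    field_simp
  by_contra! H
  -- Both $3/2$ and $3/2+\delta$ lie in $(1,2)$, while $0<\delta\|\zeta\|\le1<2\pi$, so the cosine
  -- cannot equal 1 at both points of the ray.
  set δ : ℝ := min (1 / 4) (1 / ‖ζ‖)
  have hδ0 : 0 < δ := by positivity
  have hδ1 : δ ≤ 1 / 4 := min_le_left _ _
  have hδ2 : δ * ‖ζ‖ ≤ 1 := by
    rw [← le_div_iff₀ hpos]; exact min_le_right _ _
  have h1 := H _ (hmem (3 / 2) (by norm_num) (by norm_num))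
  have h2 := H _ (hmem (3 / 2 + δ) (by linarith) (by linarith))
  rw [hinner] at h1 h2
  rw [add_mul, Real.cos_add, h1] at h2
  have h3 : Real.sin (3 / 2 * ‖ζ‖) = 0 := by
    have := Real.sin_sq_add_cos_sq (3 / 2 * ‖ζ‖)
    rw [h1] at this
    nlinarith
  rw [h3, one_mul, zero_mul, sub_zero] at h2
  have h4 := (Real.cos_eq_one_iff_of_lt_of_lt (by nlinarith [Real.pi_gt_three, mul_pos hδ0 hpos])
    (by nlinarith [Real.pi_gt_three])).1 h2
  exact (mul_pos hδ0 hpos).ne' h4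

theorem annulusSymbol_pos {ζ : EuclideanSpace ℝ (Fin n)} (hζ : ζ ≠ 0) : 0 < annulusSymbol n ζ := by
  have hcont : Continuous fun y : EuclideanSpace ℝ (Fin n) => 1 - Real.cos ⟪ζ, y⟫ := by fun_prop
  rw [annulusSymbol, setIntegral_pos_iff_support_of_nonneg_ae
    (Eventually.of_forall fun y => by simpa using Real.cos_le_one ⟪ζ, y⟫)
    (integrableOn_dyadicAnnulus hcont 1)]
  obtain ⟨y, hy, hy'⟩ := exists_mem_dyadicAnnulus_cos_ne_one hζ
  exact (hcont.isOpen_support.inter (isOpen_dyadicAnnulus 1)).measure_pos volume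
    ⟨y, sub_ne_zero.2 (Ne.symm hy'), hy⟩

/-- The oscillating part is the Fourier transform of an indicator, ready for the Riemann–Lebesgue
lemma. -/
theorem annulusSymbol_eq (ζ : EuclideanSpace ℝ (Fin n)) :
    annulusSymbol n ζ = volume.real (dyadicAnnulus n 1) -
      (∫ y, Real.fourierChar (-⟪y, (-(2 * Real.pi)⁻¹) • ζ⟫) •
        (dyadicAnnulus n 1).indicator (fun _ => (1 : ℂ)) y).re := by
  have h1 : ∀ y, Real.fourierChar (-⟪y, (-(2 * Real.pi)⁻¹) • ζ⟫) •
        (dyadicAnnulus n 1).indicator (fun _ => (1 : ℂ)) y =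
      (dyadicAnnulus n 1).indicator (fun y => Complex.exp ((⟪ζ, y⟫ : ℝ) * Complex.I)) y := by
    intro y
    by_cases hy : y ∈ dyadicAnnulus n 1
    · simp only [Set.indicator_of_mem hy, Circle.smul_def, Real.fourierChar_apply, smul_eq_mul,
        mul_one, inner_smul_right, real_inner_comm y ζ]
      congr 2
      push_cast
      have : (Real.pi : ℂ) ≠ 0 := by exact_mod_cast Real.pi_ne_zero
      field_simp
    · simp [Set.indicator_of_notMem hy]
  have hmeas := (isOpen_dyadicAnnulus (n := n) 1).measurableSet
  have hc : Continuous fun y : EuclideanSpace ℝ (Fin n) =>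
    Complex.exp ((⟪ζ, y⟫ : ℝ) * Complex.I) := by fun_prop
  have hc' : Continuous fun y : EuclideanSpace ℝ (Fin n) => Real.cos ⟪ζ, y⟫ := by fun_prop
  have h2 := integral_re (integrableOn_dyadicAnnulus hc 1)
  simp only [RCLike.re_eq_complex_re, Complex.exp_ofReal_mul_I_re] at h2
  simp only [h1]
  rw [integral_indicator hmeas, ← h2, annulusSymbol,
    integral_sub (integrableOn_dyadicAnnulus continuous_const 1)
      (integrableOn_dyadicAnnulus hc' 1)]
  simp

theorem tendsto_annulusSymbol :
    Tendsto (annulusSymbol n) (cocompact _) (𝓝 (volume.real (dyadicAnnulus n 1))) := by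
  have h1 := (tendsto_integral_exp_inner_smul_cocompact (V := EuclideanSpace ℝ (Fin n))
    ((dyadicAnnulus n 1).indicator (fun _ => (1 : ℂ))))
  have hne : -(2 * Real.pi)⁻¹ ≠ 0 := neg_ne_zero.2 (inv_ne_zero (by positivity))
  have h2 := h1.comp (Homeomorph.smulOfNeZero (α := EuclideanSpace ℝ (Fin n))
    (-(2 * Real.pi)⁻¹) hne).isClosedEmbedding.tendsto_cocompact
  have h3 := ((Complex.continuous_re.tendsto 0).comp h2).const_sub (volume.real (dyadicAnnulus n 1))
  simp only [Complex.zero_re, sub_zero] at h3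
  refine h3.congr fun ζ => ?_
  rw [annulusSymbol_eq]
  rfl

/-- Riemann–Lebesgue keeps the symbol above half the annulus volume outside a compact set; on the
rest of $\|\zeta\|\ge1$ a positive continuous function has a positive minimum. -/
theorem exists_pos_le_annulusSymbol (hn : 1 ≤ n) :
    ∃ c, 0 < c ∧ ∀ ζ : EuclideanSpace ℝ (Fin n), 1 ≤ ‖ζ‖ → c ≤ annulusSymbol n ζ := by
  have : Nonempty (Fin n) := ⟨⟨0, hn⟩⟩
  have hV : 0 < volume.real (dyadicAnnulus n 1) := by
    obtain ⟨v, hv⟩ := exists_ne (0 : EuclideanSpace ℝ (Fin n))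
    obtain ⟨y, hy, -⟩ := exists_mem_dyadicAnnulus_cos_ne_one hv
    exact ENNReal.toReal_pos ((isOpen_dyadicAnnulus 1).measure_pos volume ⟨y, hy⟩).ne'
      (volume_dyadicAnnulus_lt_top 1).ne
  have hev := tendsto_annulusSymbol.eventually (lt_mem_nhds (half_lt_self hV))
  obtain ⟨K, hK, hKs⟩ := mem_cocompact.1 hev
  have hK' : IsCompact (K ∩ {ζ | 1 ≤ ‖ζ‖}) :=
    hK.inter_right (isClosed_le continuous_const continuous_norm)
  rcases (K ∩ {ζ | 1 ≤ ‖ζ‖}).eq_empty_or_nonempty with he | hne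
  · refine ⟨_, half_pos hV, fun ζ hζ => le_of_lt (hKs fun hmem => ?_)⟩
    exact (Set.eq_empty_iff_forall_notMem.1 he) ζ ⟨hmem, hζ⟩
  · obtain ⟨ζ₀, hζ₀, hmin⟩ := hK'.exists_isMinOn hne continuous_annulusSymbol.continuousOn
    have h0 : ζ₀ ≠ 0 := by
      rintro rfl
      have := hζ₀.2
      simp only [Set.mem_ofPred_eq, norm_zero] at this
      linarith
    refine ⟨min (volume.real (dyadicAnnulus n 1) / 2) (annulusSymbol n ζ₀),
      lt_min (half_pos hV) (annulusSymbol_pos h0), fun ζ hζ => ?_⟩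
    by_cases hmem : ζ ∈ K
    · exact (min_le_right _ _).trans (hmin ⟨hmem, hζ⟩)
    · exact (min_le_left _ _).trans (le_of_lt (hKs hmem))

theorem ae_norm_le_one_truncJumpMeasure (f : ℝ → ℝ) : ∀ᵐ y ∂truncJumpMeasure n f, ‖y‖ ≤ 1 := by
  refine (withDensity_absolutelyContinuous _ _).ae_le ?_
  filter_upwards [self_mem_ae_restrict measurableSet_ball] with y hy
  exact le_of_lt (by simpa using hy)

theorem integrable_norm_sq_truncJumpMeasure {f : ℝ → ℝ}
    (hν : IsLevyMeasure (truncJumpMeasure n f)) :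
    Integrable (fun y : EuclideanSpace ℝ (Fin n) => ‖y‖ ^ 2) (truncJumpMeasure n f) := by
  refine ⟨(by fun_prop : Continuous fun y : EuclideanSpace ℝ (Fin n) =>
    ‖y‖ ^ 2).aestronglyMeasurable, ?_⟩
  rw [hasFiniteIntegral_iff_ofReal (Eventually.of_forall fun y => by positivity)]
  refine lt_of_eq_of_lt (lintegral_congr_ae ?_) hν.2
  filter_upwards [ae_norm_le_one_truncJumpMeasure f] with y hy
  rw [min_eq_right (pow_le_one₀ (norm_nonneg y) hy)]

/-- On the annulus $|y|<2r\le1/R$, so $f(|y|^{-2})\ge f(R^2)$ and $|y|^{-n}\ge(2r)^{-n}$. -/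
theorem smul_volume_restrict_le_truncJumpMeasure {f : ℝ → ℝ} (hf : MonotoneOn f (Set.Ici 0))
    {R r : ℝ} (hR : 1 ≤ R) (hfR : 0 ≤ f (R ^ 2)) (hr : 0 < r) (hrR : 2 * r * R ≤ 1) :
    ENNReal.ofReal (f (R ^ 2) / (2 * r) ^ n) •
        (volume : Measure (EuclideanSpace ℝ (Fin n))).restrict (dyadicAnnulus n r) ≤
      (truncJumpMeasure n f).restrict (dyadicAnnulus n r) := by
  have hmeas := (isOpen_dyadicAnnulus (n := n) r).measurableSet
  have hsub : dyadicAnnulus n r ⊆ Metric.ball 0 1 :=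
    (dyadicAnnulus_subset_ball r).trans (Metric.ball_subset_ball (by nlinarith))
  rw [truncJumpMeasure, restrict_withDensity hmeas, Measure.restrict_restrict hmeas,
    Set.inter_eq_self_of_subset_left hsub, ← withDensity_const]
  refine withDensity_mono ?_
  filter_upwards [self_mem_ae_restrict hmeas] with y hy
  have hy0 : 0 < ‖y‖ := hr.trans hy.1
  have h1 : ‖y‖ * R ≤ 1 := (mul_le_mul_of_nonneg_right hy.2.le (by linarith)).trans hrR
  have h2 : R ^ 2 ≤ 1 / ‖y‖ ^ 2 := by
    rw [le_div_iff₀ (by positivity), ← mul_pow, mul_comm R]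
    exact pow_le_one₀ (by positivity) h1
  have h3 : f (R ^ 2) ≤ f (1 / ‖y‖ ^ 2) :=
    hf (by simp only [Set.mem_Ici]; positivity) (by simp only [Set.mem_Ici]; positivity) h2
  refine ENNReal.ofReal_le_ofReal (div_le_div₀ (hfR.trans h3) h3 (by positivity) ?_)
  exact pow_le_pow_left₀ hy0.le hy.2.le n

/-- `ψ₁` grows at least like `f(R²) log (|ξ| / R)`. -/
theorem exists_pos_mul_le_psiOne (hn : 1 ≤ n) {f : ℝ → ℝ} (hf : MonotoneOn f (Set.Ici 0))
    (hν : IsLevyMeasure (truncJumpMeasure n f)) :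
    ∃ c, 0 < c ∧ ∀ (R : ℝ) (N : ℕ) (ξ : EuclideanSpace ℝ (Fin n)), 1 ≤ R → 0 ≤ f (R ^ 2) →
      2 ^ N * R ≤ ‖ξ‖ → c * f (R ^ 2) * N ≤ psiOne n f ξ := by
  obtain ⟨c, hc, hcle⟩ := exists_pos_le_annulusSymbol hn
  refine ⟨c / 2 ^ n, by positivity, fun R N ξ hR hfR hξ => ?_⟩
  set ν := truncJumpMeasure n f with hν_def
  have hI := integrable_norm_sq_truncJumpMeasure hν
  have hB := ae_norm_le_one_truncJumpMeasure (n := n) f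
  have hR0 : 0 < R := by linarith
  -- The outermost annulus ends at $2r_0=1/R$, consecutive ones abut since $2r_{k+1}=r_k$, and
  -- $r_k\|\xi\|\ge1$ for every $k<N$.
  let r : ℕ → ℝ := fun k => (2 ^ (k + 1) * R)⁻¹
  have hr0 : ∀ k, 0 < r k := fun k => by positivity
  have hint := integrable_one_sub_cos hI hB ξ
  have hnn : ∀ y : EuclideanSpace ℝ (Fin n), 0 ≤ 1 - Real.cos ⟪ξ, y⟫ := fun y => by
    simpa using Real.cos_le_one ⟪ξ, y⟫
  have hpiece : ∀ k ∈ Finset.range N,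
      c / 2 ^ n * f (R ^ 2) ≤ ∫ y in dyadicAnnulus n (r k), (1 - Real.cos ⟪ξ, y⟫) ∂ν := by
    intro k hk
    have hk' : k + 1 ≤ N := Finset.mem_range.1 hk
    have hrR : 2 * r k * R ≤ 1 := by
      have h1 : (1 : ℝ) ≤ 2 ^ k := one_le_pow₀ (by norm_num)
      have h2 : 2 * r k * R = (2 ^ k)⁻¹ := by
        simp only [r, pow_succ]
        field_simp
      rw [h2]
      exact inv_le_one_of_one_le₀ h1
    have h1 := integral_mono_measure
      (smul_volume_restrict_le_truncJumpMeasure (n := n) hf hR hfR (hr0 k) hrR)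
      (Eventually.of_forall hnn) hint.integrableOn
    rw [integral_smul_measure, setIntegral_dyadicAnnulus (hr0 k),
      ENNReal.toReal_ofReal (div_nonneg hfR (pow_nonneg (by linarith [hr0 k]) n))] at h1
    refine le_trans ?_ h1
    have h2 : c ≤ annulusSymbol n (r k • ξ) := by
      refine hcle _ ?_
      rw [norm_smul, Real.norm_of_nonneg (hr0 k).le]
      simp only [r]
      rw [inv_mul_eq_div, one_le_div (by positivity)]
      refine le_trans (mul_le_mul_of_nonneg_right ?_ hR0.le) hξ
      exact pow_le_pow_right₀ (by norm_num) hk'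
    have hrn : (r k) ^ n ≠ 0 := (pow_pos (hr0 k) n).ne'
    have h3 : (f (R ^ 2) / (2 * r k) ^ n) • (r k ^ n * annulusSymbol n (r k • ξ)) =
        f (R ^ 2) / 2 ^ n * annulusSymbol n (r k • ξ) := by
      rw [smul_eq_mul, mul_pow]
      field_simp
    rw [h3]
    calc c / 2 ^ n * f (R ^ 2) = f (R ^ 2) / 2 ^ n * c := by ring
      _ ≤ _ := mul_le_mul_of_nonneg_left h2 (by positivity)
  have hdisj : Set.PairwiseDisjoint (↑(Finset.range N)) (fun k => dyadicAnnulus n (r k)) := by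
    have key : ∀ k l : ℕ, k < l → Disjoint (dyadicAnnulus n (r k)) (dyadicAnnulus n (r l)) := by
      intro k l hkl
      rw [Set.disjoint_left]
      rintro y hk hl
      have : 2 * r l ≤ r k := by
        have h1 : 2 * r l = (2 ^ l * R)⁻¹ := by
          simp only [r, pow_succ]
          field_simp
        rw [h1]
        exact inv_anti₀ (by positivity)
          (mul_le_mul_of_nonneg_right (pow_le_pow_right₀ (by norm_num) hkl) hR0.le)
      linarith [hk.1, hl.2]
    intro k _ l _ hkl
    rcases lt_or_gt_of_ne hkl with h | h
    · exact key k l h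
    · exact (key l k h).symm
  calc c / 2 ^ n * f (R ^ 2) * N = ∑ _k ∈ Finset.range N, c / 2 ^ n * f (R ^ 2) := by
        rw [Finset.sum_const, Finset.card_range, nsmul_eq_mul, mul_comm]
    _ ≤ ∑ k ∈ Finset.range N, ∫ y in dyadicAnnulus n (r k), (1 - Real.cos ⟪ξ, y⟫) ∂ν :=
        Finset.sum_le_sum hpiece
    _ = ∫ y in ⋃ k ∈ Finset.range N, dyadicAnnulus n (r k), (1 - Real.cos ⟪ξ, y⟫) ∂ν :=
        (integral_biUnion_finset _ (fun k _ => (isOpen_dyadicAnnulus _).measurableSet) hdisj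
          (fun k _ => hint.integrableOn)).symm
    _ ≤ psiOne n f ξ := setIntegral_le_integral hint (Eventually.of_forall hnn)

/-- For $2^N\le u<2^{N+1}$, $u=\|\xi\|/R$, the symbol bound gives $e^{-t\psi_1}\le2^{-kN}$. The
constant 4 covers $1+u\le4\cdot2^N$ and makes the case $u<1$ trivial. -/
theorem exp_neg_mul_psiOne_le {f : ℝ → ℝ} {c : ℝ}
    (hc : ∀ (R : ℝ) (N : ℕ) (ξ : EuclideanSpace ℝ (Fin n)), 1 ≤ R → 0 ≤ f (R ^ 2) →
      2 ^ N * R ≤ ‖ξ‖ → c * f (R ^ 2) * N ≤ psiOne n f ξ) {t R : ℝ} (ht : 0 ≤ t) (hR : 1 ≤ R)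
    (hfR : 0 ≤ f (R ^ 2)) {k : ℕ} (hk : k * Real.log 2 ≤ t * (c * f (R ^ 2)))
    (ξ : EuclideanSpace ℝ (Fin n)) :
    Real.exp (-(t * psiOne n f ξ)) ≤ (4 / (1 + ‖ξ‖ / R)) ^ k := by
  have hR0 : 0 < R := by linarith
  have hu : 0 ≤ ‖ξ‖ / R := by positivity
  rcases lt_or_ge (‖ξ‖ / R) 1 with h | h
  · have h1 : Real.exp (-(t * psiOne n f ξ)) ≤ 1 :=
      Real.exp_le_one_iff.2 (neg_nonpos.2 (mul_nonneg ht (levySymbol_nonneg ξ)))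
    refine h1.trans (one_le_pow₀ ?_)
    rw [le_div_iff₀ (by linarith)]
    linarith
  · obtain ⟨N, hN1, hN2⟩ := exists_nat_pow_near h (one_lt_two)
    have h1 := hc R N ξ hR hfR ((le_div_iff₀ hR0).1 hN1)
    have h2 : (k * Real.log 2) * N ≤ t * psiOne n f ξ :=
      calc _ ≤ (t * (c * f (R ^ 2))) * N := mul_le_mul_of_nonneg_right hk (by positivity)
        _ = t * (c * f (R ^ 2) * N) := by ring
        _ ≤ _ := mul_le_mul_of_nonneg_left h1 ht
    have h3 : Real.exp (-(k * Real.log 2 * N)) = ((2 ^ N)⁻¹ : ℝ) ^ k := by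
      rw [Real.exp_neg, show (k : ℝ) * Real.log 2 * N = ((N * k : ℕ) : ℝ) * Real.log 2 by
        push_cast; ring, Real.exp_nat_mul, Real.exp_log two_pos, inv_pow, pow_mul]
    calc Real.exp (-(t * psiOne n f ξ)) ≤ Real.exp (-(k * Real.log 2 * N)) :=
          Real.exp_le_exp.2 (neg_le_neg h2)
      _ = ((2 ^ N)⁻¹ : ℝ) ^ k := h3
      _ ≤ _ := by
        refine pow_le_pow_left₀ (by positivity) ?_ k
        rw [le_div_iff₀ (by linarith), inv_mul_le_iff₀ (by positivity)]
        rw [pow_succ] at hN2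
        linarith

end SymbolLowerBound

/-! ### Existence of the minimiser and the integral of $e^{-t\psi_1}$. -/

section HeatKernelBound

variable {n : ℕ}

theorem Real.one_add_half_sq_le_cosh (a : ℝ) : 1 + a ^ 2 / 2 ≤ Real.cosh a := by
  have h1 : Real.cosh a = 2 * Real.sinh (a / 2) ^ 2 + 1 := by
    have := Real.cosh_two_mul (a / 2)
    rw [mul_div_cancel₀ a two_ne_zero, Real.cosh_sq] at this
    linarith
  have h2 : (a / 2) ^ 2 ≤ Real.sinh (a / 2) ^ 2 := by
    rw [sq_le_sq, Real.abs_sinh]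
    exact Real.self_le_sinh_iff.2 (abs_nonneg _)
  nlinarith

/-- Pointwise, $l^2(1-\cos(a/l))\le a^2/2\le\cosh a-1$. A lower bound for the symbol on one sphere
thus becomes quadratic growth of $-w$. -/
theorem sq_mul_levySymbol_le_neg_levyW {ν : Measure (EuclideanSpace ℝ (Fin n))}
    (hI : Integrable (fun y : EuclideanSpace ℝ (Fin n) => ‖y‖ ^ 2) ν)
    (hB : ∀ᵐ y ∂ν, ‖y‖ ≤ 1) {l : ℝ} (hl : 0 < l) (ξ : EuclideanSpace ℝ (Fin n)) :
    l ^ 2 * levySymbol ν (l⁻¹ • ξ) ≤ -levyW ν ξ := by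
  rw [levySymbol, levyW, ← integral_const_mul, ← integral_neg]
  refine integral_mono ((integrable_one_sub_cos hI hB _).const_mul _)
    (integrable_one_sub_cosh hI hB ξ).neg fun y => ?_
  simp only [inner_smul_left, conj_trivial]
  have h1 := Real.one_sub_sq_div_two_le_cos (x := l⁻¹ * ⟪ξ, y⟫)
  have h2 := Real.one_add_half_sq_le_cosh ⟪ξ, y⟫
  have h3 : l ^ 2 * (1 - Real.cos (l⁻¹ * ⟪ξ, y⟫)) ≤ l ^ 2 * ((l⁻¹ * ⟪ξ, y⟫) ^ 2 / 2) :=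
    mul_le_mul_of_nonneg_left (by linarith) (by positivity)
  have h4 : l ^ 2 * ((l⁻¹ * ⟪ξ, y⟫) ^ 2 / 2) = ⟪ξ, y⟫ ^ 2 / 2 := by field_simp
  linarith

theorem continuous_levyW {ν : Measure (EuclideanSpace ℝ (Fin n))}
    (hI : Integrable (fun y : EuclideanSpace ℝ (Fin n) => ‖y‖ ^ 2) ν)
    (hB : ∀ᵐ y ∂ν, ‖y‖ ≤ 1) : Continuous (levyW ν) := by
  refine continuous_integral_of_norm_le_sq hI hB (k := fun ξ y => 1 - Real.cosh ⟪ξ, y⟫)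
    (by fun_prop) fun R => ⟨Real.cosh R ^ 2 * R ^ 2, fun ξ y hξ hy => ?_⟩
  have h := norm_one_sub_cos_phase_le (η := ξ) (ξ := 0) (y := y) (z := Complex.I) hy
    (B := R) (by simpa using hξ)
  rw [inner_zero_left, Complex.ofReal_zero, zero_add, mul_comm Complex.I, Complex.cos_mul_I,
    ← Complex.ofReal_cosh, ← Complex.ofReal_one, ← Complex.ofReal_sub, Complex.norm_real,
    norm_zero, zero_add] at h
  exact h

theorem levyW_neg (ν : Measure (EuclideanSpace ℝ (Fin n))) (ξ : EuclideanSpace ℝ (Fin n)) :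
    levyW ν (-ξ) = levyW ν ξ := by
  simp [levyW, inner_neg_left]

theorem exists_isMinOn_levyV {ν : Measure (EuclideanSpace ℝ (Fin n))}
    (hI : Integrable (fun y : EuclideanSpace ℝ (Fin n) => ‖y‖ ^ 2) ν)
    (hB : ∀ᵐ y ∂ν, ‖y‖ ≤ 1) {ρ m : ℝ} (hρ : 0 < ρ) (hm : 0 < m)
    (hψ : ∀ ξ : EuclideanSpace ℝ (Fin n), ‖ξ‖ = ρ → m ≤ levySymbol ν ξ) {t : ℝ} (ht : 0 < t)
    (x : EuclideanSpace ℝ (Fin n)) :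
    ∃ ξ₀, IsMinOn (fun ξ => levyV ν t ξ x) Set.univ ξ₀ := by
  have hW := continuous_levyW hI hB
  have hcont : Continuous fun ξ => levyV ν t ξ x := by
    unfold levyV
    fun_prop
  -- Scaling `ξ` onto the sphere of radius `ρ` with $l=\|\xi\|/\rho$ gives $-tw(\xi)\ge a\|\xi\|^2$,
  -- which beats the linear term and makes $v_t$ coercive.
  set a : ℝ := t * m / ρ ^ 2
  have ha : 0 < a := by positivity
  have hlow : ∀ ξ : EuclideanSpace ℝ (Fin n), ‖ξ‖ * (a * ‖ξ‖ - ‖x‖) ≤ levyV ν t ξ x := by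
    intro ξ
    rcases eq_or_ne ξ 0 with rfl | hξ
    · simp [levyV, levyW]
    have hξ0 : 0 < ‖ξ‖ := norm_pos_iff.2 hξ
    have h1 := sq_mul_levySymbol_le_neg_levyW hI hB (l := ‖ξ‖ / ρ) (by positivity) ξ
    have h2 : m ≤ levySymbol ν ((‖ξ‖ / ρ)⁻¹ • ξ) := by
      apply hψ
      rw [norm_smul, Real.norm_of_nonneg (by positivity)]
      field_simp
    have h3 : t * ((‖ξ‖ / ρ) ^ 2 * m) ≤ t * (-levyW ν ξ) :=
      mul_le_mul_of_nonneg_left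
        ((mul_le_mul_of_nonneg_left h2 (by positivity)).trans h1) ht.le
    have h4 : t * ((‖ξ‖ / ρ) ^ 2 * m) = a * ‖ξ‖ ^ 2 := by
      simp only [a]
      field_simp
    have h5 := real_inner_le_norm ξ x
    rw [levyV]
    nlinarith
  have hlim : Tendsto (fun ξ : EuclideanSpace ℝ (Fin n) => ‖ξ‖ * (a * ‖ξ‖ - ‖x‖))
      (cocompact _) atTop := by
    have h1 := tendsto_norm_cocompact_atTop (E := EuclideanSpace ℝ (Fin n))
    exact h1.atTop_mul_atTop₀ (tendsto_atTop_add_const_right _ (-‖x‖) (h1.const_mul_atTop ha))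
  obtain ⟨ξ₀, hξ₀⟩ := hcont.exists_forall_le (tendsto_atTop_mono hlow hlim)
  exact ⟨ξ₀, fun ξ _ => hξ₀ ξ⟩

theorem integrable_one_add_norm_pow_mul_exp {f : ℝ → ℝ} {c : ℝ} (hc0 : 0 < c)
    (hc : ∀ (R : ℝ) (N : ℕ) (ξ : EuclideanSpace ℝ (Fin n)), 1 ≤ R → 0 ≤ f (R ^ 2) →
      2 ^ N * R ≤ ‖ξ‖ → c * f (R ^ 2) * N ≤ psiOne n f ξ) (hf : Tendsto f atTop atTop)
    (hcont : Continuous (psiOne n f)) {t : ℝ} (ht : 0 < t) (j : ℕ) :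
    Integrable fun ξ : EuclideanSpace ℝ (Fin n) =>
      (1 + ‖ξ‖) ^ j * Real.exp (-(t * psiOne n f ξ)) := by
  -- `j` powers absorb the weight and `n + 1` give integrability; as $f$ is unbounded, some `R`
  -- achieves this decay for the given `t`.
  set k : ℕ := j + (n + 1)
  have hsq : Tendsto (fun R : ℝ => f (R ^ 2)) atTop atTop :=
    hf.comp (tendsto_pow_atTop two_ne_zero)
  obtain ⟨R, ⟨hfR, hkR⟩, hR⟩ := (((hsq.eventually_ge_atTop 0).and
    (hsq.eventually_ge_atTop (k * Real.log 2 / (t * c)))).and (eventually_ge_atTop 1)).exists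
  have hR0 : 0 < R := by linarith
  have hk : k * Real.log 2 ≤ t * (c * f (R ^ 2)) := by
    rw [div_le_iff₀ (by positivity)] at hkR
    linarith
  have hJ : Integrable fun ξ : EuclideanSpace ℝ (Fin n) => (1 + ‖ξ‖) ^ (-((n + 1 : ℕ) : ℝ)) :=
    integrable_one_add_norm (by simp)
  refine (hJ.const_mul ((4 * R) ^ k)).mono'
    (by fun_prop : Continuous _).aestronglyMeasurable (Eventually.of_forall fun ξ => ?_)
  have hξ := norm_nonneg ξ
  rw [Real.norm_of_nonneg (by positivity), Real.rpow_neg (by positivity), Real.rpow_natCast]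
  have h1 := exp_neg_mul_psiOne_le hc ht.le hR hfR hk ξ
  have h2 : 4 / (1 + ‖ξ‖ / R) ≤ 4 * R / (1 + ‖ξ‖) := by
    rw [div_le_div_iff₀ (by positivity) (by positivity)]
    have : R * (1 + ‖ξ‖ / R) = R + ‖ξ‖ := by field_simp
    nlinarith
  calc (1 + ‖ξ‖) ^ j * Real.exp (-(t * psiOne n f ξ))
      ≤ (1 + ‖ξ‖) ^ j * (4 * R / (1 + ‖ξ‖)) ^ k :=
        mul_le_mul_of_nonneg_left (h1.trans (pow_le_pow_left₀ (by positivity) h2 k))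
          (by positivity)
    _ = (4 * R) ^ k * ((1 + ‖ξ‖) ^ (n + 1))⁻¹ := by
        rw [div_pow, show (1 + ‖ξ‖) ^ k = (1 + ‖ξ‖) ^ j * (1 + ‖ξ‖) ^ (n + 1) from pow_add _ _ _]
        field_simp

/-- Decay of order $n+1$ is integrable, and rescaling $\xi$ by $R$ produces the factor $R^n$. -/
theorem integral_exp_neg_mul_psiOne_le {f : ℝ → ℝ} {c : ℝ}
    (hc : ∀ (R : ℝ) (N : ℕ) (ξ : EuclideanSpace ℝ (Fin n)), 1 ≤ R → 0 ≤ f (R ^ 2) →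
      2 ^ N * R ≤ ‖ξ‖ → c * f (R ^ 2) * N ≤ psiOne n f ξ) {t R : ℝ} (ht : 0 ≤ t) (hR : 1 ≤ R)
    (hfR : 0 ≤ f (R ^ 2)) (hk : (n + 1 : ℕ) * Real.log 2 ≤ t * (c * f (R ^ 2))) :
    ∫ ξ : EuclideanSpace ℝ (Fin n), Real.exp (-(t * psiOne n f ξ)) ≤
      4 ^ (n + 1) * (∫ ξ : EuclideanSpace ℝ (Fin n), (1 + ‖ξ‖) ^ (-((n + 1 : ℕ) : ℝ))) * R ^ n := by
  have hR0 : 0 < R := by linarith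
  have hJ : Integrable fun ξ : EuclideanSpace ℝ (Fin n) => (1 + ‖ξ‖) ^ (-((n + 1 : ℕ) : ℝ)) :=
    integrable_one_add_norm (by simp)
  have hscale := Measure.integral_comp_inv_smul_of_nonneg
    (volume : Measure (EuclideanSpace ℝ (Fin n)))
    (fun ξ => (1 + ‖ξ‖) ^ (-((n + 1 : ℕ) : ℝ))) hR0.le
  rw [finrank_euclideanSpace_fin, smul_eq_mul] at hscale
  rw [mul_assoc, mul_comm _ (R ^ n), ← hscale, ← integral_const_mul]
  refine integral_mono_of_nonneg (Eventually.of_forall fun ξ => (Real.exp_pos _).le)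
    ((hJ.comp_smul (inv_ne_zero hR0.ne')).const_mul _) (Eventually.of_forall fun ξ => ?_)
  refine (exp_neg_mul_psiOne_le hc ht hR hfR hk ξ).trans_eq ?_
  have hξ := norm_nonneg ξ
  simp only [norm_smul, norm_inv, Real.norm_of_nonneg hR0.le]
  rw [Real.rpow_neg (by positivity), Real.rpow_natCast, div_pow, inv_mul_eq_div, div_eq_mul_inv]


theorem re_charFunInv_le {ν : Measure (EuclideanSpace ℝ (Fin n))}
    (hI : Integrable (fun y : EuclideanSpace ℝ (Fin n) => ‖y‖ ^ 2) ν)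
    (hB : ∀ᵐ y ∂ν, ‖y‖ ≤ 1) {t : ℝ} (ht : 0 ≤ t)
    (hint : Integrable fun ξ : EuclideanSpace ℝ (Fin n) => Real.exp (-(t * levySymbol ν ξ)))
    (hint' : Integrable fun ξ : EuclideanSpace ℝ (Fin n) =>
      (1 + ‖ξ‖) * Real.exp (-(t * levySymbol ν ξ))) {μ : Measure (EuclideanSpace ℝ (Fin n))}
    (hμ : ∀ ξ, charFun μ ξ = ((Real.exp (-(t * levySymbol ν ξ)) : ℝ) : ℂ))
    {x ξ₀ : EuclideanSpace ℝ (Fin n)}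
    (hmin : IsMinOn (fun ξ => levyV ν t ξ x) Set.univ ξ₀) :
    (charFunInv μ x).re ≤ ((2 * Real.pi) ^ n)⁻¹ * (Real.exp (-levyDsq ν t x) *
      ∫ ξ : EuclideanSpace ℝ (Fin n), Real.exp (-(t * levySymbol ν ξ))) := by
  refine (Complex.re_le_norm _).trans ?_
  rw [charFunInv_eq, norm_smul, finrank_euclideanSpace_fin, Real.norm_of_nonneg (by positivity)]
  simp only [hμ]
  refine mul_le_mul_of_nonneg_left ?_ (by positivity)
  -- Since $w$ is even, the shift by $-\xi_0$ turns the exponent into $v_t(\xi_0,x)$.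
  refine (norm_integral_exp_mul_exp_levySymbol_le hI hB ht hint hint' x (-ξ₀)).trans ?_
  refine mul_le_mul_of_nonneg_right ?_ (integral_nonneg fun ξ => (Real.exp_pos _).le)
  rw [Real.exp_le_exp, levyDsq, neg_neg, levyW_neg, inner_neg_left]
  exact le_ciInf fun ξ => hmin (Set.mem_univ ξ)

end HeatKernelBound

/-! ### Choice of the constants and the final estimate. -/

theorem corollary3p3 (n : ℕ) (hn : 1 ≤ n) (f : ℝ → ℝ)
    (hf : IsBernsteinNoLinear f) (hf0 : f 0 = 0)
    -- `f` is unbounded, so that `f : [0,∞) → [0,∞)` has an inverse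
    (hfinv : Tendsto f atTop atTop)
    -- the integral that defines `ψ₁` is a Lévy-Khintchine integral
    (hν : IsLevyMeasure (truncJumpMeasure n f))
    {Ω : Type*} [MeasurableSpace Ω] (P : Measure Ω) [IsProbabilityMeasure P]
    (X : ℝ≥0 → Ω → EuclideanSpace ℝ (Fin n))
    (hX : IsLevyProcess X P) (hψ : HasSymbol X P (psiOne n f)) :
    ∃ p : ℝ≥0 → EuclideanSpace ℝ (Fin n) → ℝ,
      IsContTransitionDensity X P p ∧
      -- the minimum that defines `D_t²(x)` is attained
      (∀ t : ℝ≥0, 0 < t → ∀ x : EuclideanSpace ℝ (Fin n), ∃ ξ₀ : EuclideanSpace ℝ (Fin n),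
        IsMinOn (fun ξ => levyV (truncJumpMeasure n f) t ξ x) Set.univ ξ₀) ∧
      ∃ c γ : ℝ, 0 < c ∧ 0 < γ ∧
        ∀ t : ℝ≥0, 0 < t → t ≤ 1 → ∀ x : EuclideanSpace ℝ (Fin n),
          p t x ≤ c * Real.exp (-levyDsq (truncJumpMeasure n f) t x) *
            Function.invFunOn f (Set.Ici 0) (1 / (γ * (t : ℝ))) ^ ((n : ℝ) / 2) := by
  obtain ⟨a, μ, hrep⟩ := hf
  have hmono := hrep.monotoneOn
  have hI := integrable_norm_sq_truncJumpMeasure hν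
  have hB := ae_norm_le_one_truncJumpMeasure (n := n) f
  have hcont : Continuous (psiOne n f) := continuous_levySymbol hI hB
  obtain ⟨c₀, hc₀, hc⟩ := exists_pos_mul_le_psiOne hn hmono hν
  have hf_nonneg : ∀ s : ℝ, 0 ≤ s → 0 ≤ f s := fun s hs =>
    hf0 ▸ hmono Set.self_mem_Ici hs hs
  have hint : ∀ t : ℝ, 0 < t → Integrable fun ξ : EuclideanSpace ℝ (Fin n) =>
      Real.exp (-(t * psiOne n f ξ)) := fun t ht => by
    simpa using integrable_one_add_norm_pow_mul_exp hc₀ hc hfinv hcont ht 0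
  have hint' : ∀ t : ℝ, 0 < t → Integrable fun ξ : EuclideanSpace ℝ (Fin n) =>
      (1 + ‖ξ‖) * Real.exp (-(t * psiOne n f ξ)) := fun t ht => by
    simpa using integrable_one_add_norm_pow_mul_exp hc₀ hc hfinv hcont ht 1
  have hφ : ∀ t : ℝ≥0, 0 < t → Integrable (charFun (P.map (X t))) := fun t ht => by
    rw [funext (hψ t)]
    exact (hint t ht).ofReal
  have hprob : ∀ t : ℝ≥0, IsProbabilityMeasure (P.map (X t)) := fun t =>
    Measure.isProbabilityMeasure_map (hX.measurable t).aemeasurable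
  have hmin : ∀ t : ℝ≥0, 0 < t → ∀ x : EuclideanSpace ℝ (Fin n),
      ∃ ξ₀ : EuclideanSpace ℝ (Fin n),
        IsMinOn (fun ξ => levyV (truncJumpMeasure n f) t ξ x) Set.univ ξ₀ := by
    intro t ht x
    obtain ⟨R, hfR, hR⟩ := (((hfinv.comp (tendsto_pow_atTop two_ne_zero)).eventually_ge_atTop
      1).and (eventually_ge_atTop (1 : ℝ))).exists
    have hfR' : 1 ≤ f (R ^ 2) := hfR
    -- The case $N=1$ of the symbol bound already gives positivity on the sphere of radius $2R$.
    refine exists_isMinOn_levyV hI hB (ρ := 2 * R) (m := c₀ * f (R ^ 2)) (by linarith)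
      (mul_pos hc₀ (by linarith)) (fun ξ hξ => ?_) (by exact_mod_cast ht) x
    have := hc R 1 ξ hR (by linarith) (by rw [hξ, pow_one])
    rwa [Nat.cast_one, mul_one] at this
  refine ⟨fun t x => (charFunInv (P.map (X t)) x).re, fun t ht =>
    ⟨Complex.continuous_re.comp (continuous_charFunInv (hφ t ht)), re_charFunInv_nonneg (hφ t ht),
      eq_withDensity_of_integrable_charFun (hφ t ht)⟩, hmin, ?_⟩
  set J := ∫ ξ : EuclideanSpace ℝ (Fin n), (1 + ‖ξ‖) ^ (-((n + 1 : ℕ) : ℝ))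
  have hJ : 0 ≤ J := integral_nonneg fun ξ => by positivity
  have hlog : 0 < Real.log 2 := Real.log_pos one_lt_two
  have hf1 := hf_nonneg 1 zero_le_one
  -- With $f(u)=1/(\gamma t)$, the first entry yields decay exponent $n+1$; the second forces
  -- $f(u)>f(1)$ for $t\le1$, hence $u\ge1$ and $R=\sqrt u\ge1$.
  set γ : ℝ := min (c₀ / ((n + 1 : ℕ) * Real.log 2)) (1 / (f 1 + 1))
  have hγ : 0 < γ := by positivity
  have hγ1 : (n + 1 : ℕ) * Real.log 2 ≤ c₀ / γ := by
    rw [le_div_iff₀ hγ, mul_comm, ← le_div_iff₀ (by positivity)]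
    exact min_le_left _ _
  have hγ2 : f 1 + 1 ≤ 1 / γ := by
    rw [le_div_iff₀ hγ, mul_comm, ← le_div_iff₀ (by positivity)]
    exact min_le_right _ _
  -- The added 1 makes the constant positive from $J\ge0$ alone.
  refine ⟨((2 * Real.pi) ^ n)⁻¹ * (4 ^ (n + 1) * J) + 1, γ, by positivity, hγ,
    fun t ht ht1 x => ?_⟩
  have ht' : (0 : ℝ) < t := by exact_mod_cast ht
  have ht1' : (t : ℝ) ≤ 1 := by exact_mod_cast ht1
  obtain ⟨ξ₀, hξ₀⟩ := hmin t ht x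
  have hpt := re_charFunInv_le hI hB ht'.le (hint t ht') (hint' t ht') (hψ t) hξ₀
  obtain ⟨hu0, hfu⟩ := invFunOn_Ici_spec hrep.continuousOn hf0 hfinv
    (s := 1 / (γ * (t : ℝ))) (by positivity)
  set u := Function.invFunOn f (Set.Ici 0) (1 / (γ * (t : ℝ)))
  have hu1 : 1 ≤ u := by
    by_contra! hlt
    have h1 := hmono hu0 (Set.mem_Ici.2 zero_le_one) hlt.le
    have h2 : 1 / γ ≤ 1 / (γ * t) :=
      one_div_le_one_div_of_le (by positivity) (by nlinarith)
    linarith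
  have hR2 : √u ^ 2 = u := Real.sq_sqrt hu0
  have hkey := integral_exp_neg_mul_psiOne_le hc ht'.le (Real.one_le_sqrt.2 hu1)
    (by rw [hR2]; exact hf_nonneg u hu0)
    (by
      rw [hR2, hfu]
      refine hγ1.trans_eq ?_
      field_simp)
  have hpow : √u ^ n = u ^ ((n : ℝ) / 2) := by
    rw [Real.sqrt_eq_rpow, ← Real.rpow_mul_natCast hu0]
    congr 1
    ring
  rw [hpow] at hkey
  have hupow : 0 ≤ u ^ ((n : ℝ) / 2) := Real.rpow_nonneg hu0 _
  set D := Real.exp (-levyDsq (truncJumpMeasure n f) t x)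
  have hD : 0 < D := Real.exp_pos _
  calc (charFunInv (P.map (X t)) x).re
      ≤ ((2 * Real.pi) ^ n)⁻¹ * (D * (4 ^ (n + 1) * J * u ^ ((n : ℝ) / 2))) :=
        hpt.trans (by gcongr; exact hkey)
    _ = ((2 * Real.pi) ^ n)⁻¹ * (4 ^ (n + 1) * J) * (D * u ^ ((n : ℝ) / 2)) := by ring
    _ ≤ (((2 * Real.pi) ^ n)⁻¹ * (4 ^ (n + 1) * J) + 1) * (D * u ^ ((n : ℝ) / 2)) :=
        mul_le_mul_of_nonneg_right (by linarith) (by positivity)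
    _ = _ := by ring
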